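/- Let $K\ge 1$, let $\pi=(\pi_a)_{a\in[K]}$ be a probability vector with $\pi_a>0$ for all $a$, and let $\kappa_{a,b}>0$ for all $a,b\in[K]$. Start at time $0$ with a finite connected simple graph $\mathcal G_0$ whose vertices carry attributes in $[K]$ and are listed in some order. For $n\ge 0$ a new vertex $v_{n+1}$ enters; its attribute $a(v_{n+1})$ has law $\pi$ independently of $\mathcal G_0,\dots,\mathcal G_n$, and it is joined by one edge to a random vertex of $\mathcal G_n$, with $$\mathbb P\big(v_{n+1}\leadsto v\mid \mathcal G_0,\dots,\mathcal G_n,\ a(v_{n+1})=b\big)=\frac{\kappa_{a(v),b}\deg(v,n)}{\sum_{v'\in\mathcal G_n}\kappa_{a(v'),b}\deg(v',n)},\qquad v\in\mathcal G_n ,$$ where $\deg(v,n)$ is the degree of $v$ in $\mathcal G_n$, except that if $\mathcal G_0$ is a single vertex $v_0$, then $\deg(v_0,0)=1$ and $\deg(v_0,n)$ is one more than the degree of $v_0$ in $\mathcal G_n$. Let $\eta$ be the unique minimizer, over vectors $y$ with $y_a>0$ and $\sum_a y_a=1$, of $$V_\pi(y)=1-\tfrac12\sum_{j=1}^K\pi_j\Big(\log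 y_j+\log\sum_{k=1}^K y_k\kappa_{k,j}\Big),$$ and put $\phi_a=\sum_{b=1}^K\kappa_{a,b}\,\pi_b\big/\sum_{l=1}^K\kappa_{l,b}\eta_l$. Fix $a\in[K]$. Let $F_n^a$ be the degree at time $n$ of the first vertex of type $a$ (in order of arrival, the vertices of $\mathcal G_0$ coming first in their given order), with $F_n^a=0$ if $\mathcal G_n$ has no vertex of type $a$, and let $M_n^a$ be the maximal degree at time $n$ of the vertices of type $a$ ($0$ if there are none). Then: (a) There are random normalizing constants $C_n>0$, $n\ge 0$, with $C_n$ measurable with respect to $\sigma(\mathcal G_0,\dots,\mathcal G_{\max(n-1,0)})$, and a non-negative square-integrable random variable $W_a$ that is not almost surely constant, such that each $F_n^a/C_n$ is square-integrable and $F_n^a/C_n\to W_a$ almost surely and in $L^2$; moreover $$\frac{\log C_n-\frac{\phi_a}{2}\log n}{\log n}\longrightarrow 0\quad\text{in probability.}$$ (b) For every $\varepsilon>0$, $\ M_n^a/n^{(\phi_a+\varepsilon)/2}\to 0$ in probability as $n\to\infty$. -/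

import Mathlib

open MeasureTheory Filter Topology

namespace AttributedPA

noncomputable section

/-! ## The deterministic constants -/

/-- The interior of the simplex of probability vectors on the attribute set `[K]`. -/
def simplexInterior (K : ℕ) : Set (Fin K → ℝ) :=
  {y | (∀ a, 0 < y a) ∧ ∑ a, y a = 1}

/-- `V_π(y) = 1 - (1/2) ∑_j π_j (log y_j + log ∑_k y_k κ_{k,j})`. -/
def potential {K : ℕ} (π : Fin K → ℝ) (κ : Fin K → Fin K → ℝ) (y : Fin K → ℝ) : ℝ :=
  1 - (1 / 2) * ∑ j, π j * (Real.log (y j) + Real.log (∑ k, y k * κ k j))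

/-- The minimizer `η` of `V_π` in the interior of the simplex (there is exactly one when `π` is a
strictly positive probability vector and `κ` has strictly positive entries). -/
def minimizer {K : ℕ} (π : Fin K → ℝ) (κ : Fin K → Fin K → ℝ) : Fin K → ℝ :=
  Classical.epsilon fun η =>
    η ∈ simplexInterior K ∧ ∀ y ∈ simplexInterior K, potential π κ η ≤ potential π κ y

/-- `ν_b = π_b / ∑_l κ_{l,b} η_l`. -/
def resolvingWeight {K : ℕ} (π : Fin K → ℝ) (κ : Fin K → Fin K → ℝ) (b : Fin K) : ℝ :=
  π b / ∑ l, κ l b * minimizer π κ l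

/-- `φ_a = ∑_b κ_{a,b} ν_b`. -/
def phi {K : ℕ} (π : Fin K → ℝ) (κ : Fin K → Fin K → ℝ) (a : Fin K) : ℝ :=
  ∑ b, κ a b * resolvingWeight π κ b

/-! ## The evolving network

Vertices carry the labels `0, 1, 2, …` in the order of their arrival: the `n₀` vertices of the base
graph have the labels `0, …, n₀ - 1`, and the vertex `v_{n+1}`, which enters at time `n + 1`, has
the label `n₀ + n`. Hence the vertices present at time `n` are the labels `v < n₀ + n`. -/

/-- A possible evolution of the network: the `n`-th entry is the attribute of the vertex `v_{n+1}`
together with the vertex present at time `n` to which `v_{n+1}` attaches. -/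
abbrev Evolution (K n₀ : ℕ) : Type := (n : ℕ) → Fin K × Fin (n₀ + n)

section Network

variable {K n₀ : ℕ} (G₀ : SimpleGraph (Fin n₀)) (attr₀ : Fin n₀ → Fin K) (x : Evolution K n₀)

/-- The attribute of the vertex with label `v`. -/
def attrOf (v : ℕ) : Fin K :=
  if h : v < n₀ then attr₀ ⟨v, h⟩ else (x (v - n₀)).1

/-- The graph at time `n`: the edges of the base graph, together with one edge from each of
`v_1, …, v_n` to the vertex that it attached to on arrival. (Labels `≥ n₀ + n` are isolated.) -/
def graphAt (n : ℕ) : SimpleGraph ℕ :=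
  SimpleGraph.fromRel fun u v =>
    (∃ i j : Fin n₀, u = i ∧ v = j ∧ G₀.Adj i j) ∨
      (∃ i < n, u = n₀ + i ∧ v = ((x i).2 : ℕ))

/-- `deg(v, n)`, the degree of `v` at time `n`, with the convention that a base graph consisting of
a single vertex starts with the degree `1` of this vertex at time `0` (instead of `0`). -/
def deg (v n : ℕ) : ℕ :=
  ((graphAt G₀ x n).neighborSet v).ncard + if n₀ = 1 ∧ v = 0 then 1 else 0

/-- The probability, given the network at time `n` and given that `v_{n+1}` has attribute `b`, that
`v_{n+1}` attaches to the vertex `v` (linear preferential attachment with kernel `κ`). -/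
def attachProb (κ : Fin K → Fin K → ℝ) (n : ℕ) (b : Fin K) (v : Fin (n₀ + n)) : ℝ :=
  (κ (attrOf attr₀ x v) b * (deg G₀ x v n : ℝ)) /
    ∑ u : Fin (n₀ + n), κ (attrOf attr₀ x u) b * (deg G₀ x u n : ℝ)

open Classical in
/-- `F_n^a`: the degree at time `n` of the first vertex of type `a`, and `0` if at time `n` there is
no vertex of type `a`. -/
def firstDeg (a : Fin K) (n : ℕ) : ℕ :=
  if h : ∃ v, v < n₀ + n ∧ attrOf attr₀ x v = a then deg G₀ x (Nat.find h) n else 0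

open Classical in
/-- `M_n^a`: the maximal degree at time `n` of the vertices of type `a` (`0` if there is none). -/
def maxDeg (a : Fin K) (n : ℕ) : ℕ :=
  ((Finset.range (n₀ + n)).filter fun v => attrOf attr₀ x v = a).sup fun v => deg G₀ x v n

end Network

/-- The random evolution `ω ↦ (X n ω)_n` follows the model with `γ = 1`, attribute distribution `π`,
kernel `κ` and one outgoing edge per vertex, started from the base graph `G₀` with attributes
`attr₀`. The event `∀ i < n, X i ω = x i` says that the network up to time `n` is the one
described by `x`. -/
structure IsModelP {K n₀ : ℕ} (π : Fin K → ℝ) (κ : Fin K → Fin K → ℝ)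
    (G₀ : SimpleGraph (Fin n₀)) (attr₀ : Fin n₀ → Fin K)
    {Ω : Type*} [MeasurableSpace Ω] (μ : Measure Ω)
    (X : (n : ℕ) → Ω → Fin K × Fin (n₀ + n)) : Prop where
  measurable : ∀ n, Measurable (X n)
  /-- `v_{n+1}` has attribute distribution `π`, independently of the network up to time `n`. -/
  attribute_law : ∀ (n : ℕ) (x : Evolution K n₀) (b : Fin K),
    μ.real {ω | (∀ i < n, X i ω = x i) ∧ (X n ω).1 = b} =
      π b * μ.real {ω | ∀ i < n, X i ω = x i}
  /-- Given the network up to time `n` and the attribute of `v_{n+1}`, the vertex that `v_{n+1}`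
  attaches to has the distribution `attachProb`. -/
  attach_law : ∀ (n : ℕ) (x : Evolution K n₀) (b : Fin K) (v : Fin (n₀ + n)),
    μ.real {ω | (∀ i < n, X i ω = x i) ∧ X n ω = (b, v)} =
      attachProb G₀ attr₀ x κ n b v *
        μ.real {ω | (∀ i < n, X i ω = x i) ∧ (X n ω).1 = b}

/-- The `σ`-algebra generated by the networks at the times `0, …, n`. -/
abbrev networkSigma {K n₀ : ℕ} {Ω : Type*} (X : (n : ℕ) → Ω → Fin K × Fin (n₀ + n)) (n : ℕ) :
    MeasurableSpace Ω :=
  ⨆ i ∈ Finset.range n, MeasurableSpace.comap (X i) inferInstance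

end

end AttributedPA

/-! Let `y` be the vector of the total degrees of the types. Averaged over its attribute, the
newcomer attaches to a vertex of type `l` and degree `d` with probability `d * rate π κ y l`. So the
degree of an existing vertex of type `a`, divided by the predictable product `normalizer` of the
factors `1 + rate π κ y a`, is a martingale. Three things remain: the size of the normalizer, moment
bounds, and non-degeneracy of the limit.

Size. The rate is homogeneous of degree -1 and the total degree is a constant plus `2 * n`, so if
`y` is close to a multiple of `η`, the rate is close to `φ_a / (2 n)` and the logarithm of the
normalizer to `φ_a / 2 * log n`. Only an averaged form of this closeness is needed. The function
`lyap` is, up to a constant, the relative entropy of `η` with respect to the normalised degrees,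
plus a sum of multiples of reciprocals that absorbs second-order errors; degrees are shifted by one
so that absent types do no harm. Minimality of `η` (`two_add_le_of_minimizer`) makes its drift at
most `-sqDist / N + O(1 / N ^ 2)` at total `N` (`lyap_drift`), so the expected sum of `sqDist / N`
is finite. With `|t| ≤ δ + t ^ 2 / δ` this bounds the expected error in the logarithm by `δ * log n
+ B` for every `δ > 0`, and Markov's inequality gives convergence in probability.

Moments. Rising factorials of the degrees satisfy closed linear mean equations. For a large order
`p`, their sum over all vertices of type `a`, divided by the `p`-th power of the normalizer, has
bounded mean (`IsModelP.exists_integral_risingSum_le`). This bounds the first vertex in `L²` and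
controls the maximal degree at the same time, which is (b).

Limit. The normalised first degree is a non-negative submartingale bounded in `L²`, hence converges
almost surely and in `L²`. A constant limit would force the same value on all histories of length
two whose first newcomer has type `a`; changing the target of the second newcomer refutes this. -/

namespace AttributedPA

/-! ### Deterministic recursions for degrees and total degrees by type. -/

section Network

variable {K n₀ : ℕ} (G₀ : SimpleGraph (Fin n₀)) (attr₀ : Fin n₀ → Fin K) (x : Evolution K n₀)

theorem graphAt_adj {n u v : ℕ} : (graphAt G₀ x n).Adj u v ↔
    (∃ i j : Fin n₀, u = i ∧ v = j ∧ G₀.Adj i j) ∨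
      (∃ i < n, u = n₀ + i ∧ v = ((x i).2 : ℕ)) ∨ (∃ i < n, v = n₀ + i ∧ u = ((x i).2 : ℕ)) := by
  simp only [graphAt, SimpleGraph.fromRel_adj]
  constructor
  · rintro ⟨-, (h | h) | (⟨i, j, hi, hj, h⟩ | h)⟩
    · exact Or.inl h
    · exact Or.inr (Or.inl h)
    · exact Or.inl ⟨j, i, hj, hi, h.symm⟩
    · exact Or.inr (Or.inr h)
  · rintro (⟨i, j, rfl, rfl, h⟩ | ⟨i, hi, rfl, rfl⟩ | ⟨i, hi, rfl, rfl⟩)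
    · exact ⟨fun e => h.ne (Fin.ext e), Or.inl (Or.inl ⟨i, j, rfl, rfl, h⟩)⟩
    · exact ⟨(x i).2.isLt.ne', Or.inl (Or.inr ⟨i, hi, rfl, rfl⟩)⟩
    · exact ⟨(x i).2.isLt.ne, Or.inr (Or.inr ⟨i, hi, rfl, rfl⟩)⟩

theorem graphAt_adj_lt {n u v : ℕ} (h : (graphAt G₀ x n).Adj u v) : v < n₀ + n := by
  rcases (graphAt_adj G₀ x).1 h with ⟨i, j, rfl, rfl, -⟩ | ⟨i, hi, rfl, rfl⟩ | ⟨i, hi, rfl, rfl⟩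
  · have := j.isLt; omega
  · have := (x i).2.isLt; omega
  · omega

theorem graphAt_succ_adj {n u v : ℕ} : (graphAt G₀ x (n + 1)).Adj u v ↔
    (graphAt G₀ x n).Adj u v ∨ (u = n₀ + n ∧ v = ((x n).2 : ℕ)) ∨
      (v = n₀ + n ∧ u = ((x n).2 : ℕ)) := by
  simp only [graphAt_adj, Nat.lt_succ_iff_lt_or_eq, or_and_right, exists_or, exists_eq_left]
  generalize (∃ i j : Fin n₀, _) = p
  grind

theorem finite_neighborSet (n v : ℕ) : ((graphAt G₀ x n).neighborSet v).Finite :=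
  (Set.finite_Iio (n₀ + n)).subset fun _ h => graphAt_adj_lt G₀ x h

theorem neighborSet_eq_empty {n v : ℕ} (hv : n₀ + n ≤ v) :
    (graphAt G₀ x n).neighborSet v = ∅ := by
  ext u
  simp only [SimpleGraph.mem_neighborSet, Set.mem_empty_iff_false, iff_false]
  exact fun h => absurd (graphAt_adj_lt G₀ x h.symm) (by omega)

/-- The new edge joins the label `n₀ + n`, isolated until then, to a strictly smaller label, so at
most one of the two indicators is `1` and no neighbour is counted twice. -/
theorem deg_succ (v n : ℕ) : deg G₀ x v (n + 1) =
    deg G₀ x v n + (if v = ((x n).2 : ℕ) then 1 else 0) + (if v = n₀ + n then 1 else 0) := by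
  have hlt := (x n).2.isLt
  have key : ((graphAt G₀ x (n + 1)).neighborSet v).ncard =
      ((graphAt G₀ x n).neighborSet v).ncard + (if v = ((x n).2 : ℕ) then 1 else 0) +
        (if v = n₀ + n then 1 else 0) := by
    by_cases h1 : v = ((x n).2 : ℕ)
    · have h2 : v ≠ n₀ + n := by omega
      have : (graphAt G₀ x (n + 1)).neighborSet v =
          insert (n₀ + n) ((graphAt G₀ x n).neighborSet v) := by
        ext u
        simp only [SimpleGraph.mem_neighborSet, graphAt_succ_adj, Set.mem_insert_iff]
        tauto
      have h3 : n₀ + n ∉ (graphAt G₀ x n).neighborSet v := fun h =>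
        absurd (graphAt_adj_lt G₀ x h) (by omega)
      rw [this, Set.ncard_insert_of_notMem h3 (finite_neighborSet G₀ x n v)]
      simp [h1, hlt.ne]
    · by_cases h2 : v = n₀ + n
      · have : (graphAt G₀ x (n + 1)).neighborSet v = {((x n).2 : ℕ)} := by
          ext u
          have h3 : ¬ (graphAt G₀ x n).Adj v u := fun h =>
            absurd (graphAt_adj_lt G₀ x h.symm) (by omega)
          simp only [SimpleGraph.mem_neighborSet, graphAt_succ_adj, Set.mem_singleton_iff]
          tauto
        rw [this, neighborSet_eq_empty G₀ x h2.ge]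
        simp [h2, hlt.ne']
      · have : (graphAt G₀ x (n + 1)).neighborSet v = (graphAt G₀ x n).neighborSet v := by
          ext u
          simp only [SimpleGraph.mem_neighborSet, graphAt_succ_adj]
          tauto
        simp [this, h1, h2]
  rw [deg, deg, key]
  omega

theorem deg_eq_zero {n v : ℕ} (hv : n₀ + n ≤ v) : deg G₀ x v n = 0 := by
  rw [deg, neighborSet_eq_empty G₀ x hv, if_neg (by omega)]
  simp

/-- Connectedness yields a neighbour only if there are at least two vertices; for a single vertex
the convention in `deg` supplies positivity. -/
theorem deg_zero_pos (hG₀ : G₀.Connected) {v : ℕ} (hv : v < n₀) : 0 < deg G₀ x v 0 := by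
  rw [deg]
  rcases eq_or_ne n₀ 1 with h | h
  · rw [if_pos ⟨h, by omega⟩]; omega
  · have : Nontrivial (Fin n₀) := Fin.nontrivial_iff_two_le.2 (by omega)
    obtain ⟨w, hw⟩ := hG₀.preconnected.exists_adj_of_nontrivial ⟨v, hv⟩
    have : 0 < ((graphAt G₀ x 0).neighborSet v).ncard := by
      rw [Set.ncard_pos (finite_neighborSet G₀ x 0 v)]
      exact ⟨w, (graphAt_adj G₀ x).2 (Or.inl ⟨⟨v, hv⟩, w, rfl, rfl, hw⟩)⟩
    omega

theorem deg_pos (hG₀ : G₀.Connected) {n v : ℕ} (hv : v < n₀ + n) : 0 < deg G₀ x v n := by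
  induction n with
  | zero => exact deg_zero_pos G₀ x hG₀ hv
  | succ n ih =>
    rw [deg_succ]
    rcases Nat.lt_or_ge v (n₀ + n) with h | h
    · have := ih h; omega
    · rw [if_pos (show v = n₀ + n by omega)]; omega

/-- Adaptedness in deterministic form; the other `_congr` lemmas play the same role and later become
`DependsOn` statements. -/
theorem deg_congr {x y : Evolution K n₀} {n : ℕ} (h : ∀ i < n, x i = y i) (v : ℕ) :
    deg G₀ x v n = deg G₀ y v n := by
  induction n with
  | zero =>
    have : graphAt G₀ x 0 = graphAt G₀ y 0 := by ext; simp [graphAt_adj]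
    rw [deg, deg, this]
  | succ n ih => rw [deg_succ, deg_succ, ih fun i hi => h i (by omega), h n (by omega)]

theorem attrOf_congr {x y : Evolution K n₀} {n : ℕ} (h : ∀ i < n, x i = y i) {v : ℕ}
    (hv : v < n₀ + n) : attrOf attr₀ x v = attrOf attr₀ y v := by
  unfold attrOf
  split_ifs with hv0
  · rfl
  · rw [h _ (by omega)]

@[simp] theorem attrOf_newVertex (n : ℕ) : attrOf attr₀ x (n₀ + n) = (x n).1 := by
  rw [attrOf, dif_neg (by omega)]
  exact congrArg (fun m => (x m).1) (Nat.add_sub_cancel_left n₀ n)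

/-- The total degree at time `n` of the vertices of type `l`. -/
noncomputable def typeDeg (n : ℕ) (l : Fin K) : ℝ :=
  ∑ u : Fin (n₀ + n), if attrOf attr₀ x u = l then (deg G₀ x u n : ℝ) else 0

/-- A sum over the vertices present at time `n + 1`. -/
theorem sum_vertices_succ {n : ℕ} (f : ℕ → ℝ) :
    ∑ u : Fin (n₀ + (n + 1)), f u = ∑ u : Fin (n₀ + n), f u + f (n₀ + n) :=
  Fin.sum_univ_castSucc (n := n₀ + n) (fun u => f u)

theorem sum_mul_typeDeg (n : ℕ) (f : Fin K → ℝ) :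
    ∑ l, f l * typeDeg G₀ attr₀ x n l =
      ∑ u : Fin (n₀ + n), f (attrOf attr₀ x u) * (deg G₀ x u n : ℝ) := by
  simp only [typeDeg, Finset.mul_sum]
  rw [Finset.sum_comm]
  refine Finset.sum_congr rfl fun u _ => ?_
  simp

theorem typeDeg_nonneg (n : ℕ) (l : Fin K) : 0 ≤ typeDeg G₀ attr₀ x n l :=
  Finset.sum_nonneg fun u _ => by split_ifs <;> positivity

theorem typeDeg_congr {x y : Evolution K n₀} {n : ℕ} (h : ∀ i < n, x i = y i) (l : Fin K) :
    typeDeg G₀ attr₀ x n l = typeDeg G₀ attr₀ y n l := by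
  refine Finset.sum_congr rfl fun u _ => ?_
  rw [attrOf_congr attr₀ h u.isLt, deg_congr G₀ h]

theorem typeDeg_succ (n : ℕ) (l : Fin K) : typeDeg G₀ attr₀ x (n + 1) l =
    typeDeg G₀ attr₀ x n l + (if attrOf attr₀ x (x n).2 = l then 1 else 0) +
      (if (x n).1 = l then 1 else 0) := by
  rw [typeDeg, sum_vertices_succ (fun u => if attrOf attr₀ x u = l then
    (deg G₀ x u (n + 1) : ℝ) else 0)]
  congr 1
  · have : ∀ u : Fin (n₀ + n), (if attrOf attr₀ x u = l then (deg G₀ x u (n + 1) : ℝ) else 0) =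
        (if attrOf attr₀ x u = l then (deg G₀ x u n : ℝ) else 0) +
          (if u = (x n).2 then (if attrOf attr₀ x (x n).2 = l then 1 else 0) else 0) := by
      intro u
      rw [deg_succ, if_neg (show (u : ℕ) ≠ n₀ + n from u.isLt.ne)]
      by_cases hu : u = (x n).2
      · simp only [hu, if_true]
        split_ifs <;> simp
      · have hu' : ((u : ℕ) = ((x n).2 : ℕ)) ↔ False := by
          simpa [Fin.ext_iff] using hu
        simp [hu, hu']
    simp only [this, Finset.sum_add_distrib, typeDeg]
    simp
  · rw [attrOf_newVertex, deg_succ, deg_eq_zero G₀ x le_rfl]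
    have : n₀ + n ≠ ((x n).2 : ℕ) := (x n).2.isLt.ne'
    simp [this]

/-- The total degree of the base graph. -/
noncomputable def baseDeg : ℝ := ∑ l, typeDeg G₀ attr₀ x 0 l

theorem baseDeg_congr (x y : Evolution K n₀) : baseDeg G₀ attr₀ x = baseDeg G₀ attr₀ y :=
  Finset.sum_congr rfl fun l _ => typeDeg_congr G₀ attr₀ (by simp) l

theorem one_le_baseDeg (hG₀ : G₀.Connected) : 1 ≤ baseDeg G₀ attr₀ x := by
  have hn₀ : 0 < n₀ := Fin.pos_iff_nonempty.2 hG₀.nonempty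
  have := sum_mul_typeDeg G₀ attr₀ x 0 (fun _ => 1)
  simp only [one_mul] at this
  rw [baseDeg, this]
  have h0 : (1 : ℝ) ≤ deg G₀ x (⟨0, by omega⟩ : Fin (n₀ + 0)) 0 := by
    exact_mod_cast deg_pos G₀ x hG₀ (n := 0) (v := 0) (by omega)
  exact h0.trans (Finset.single_le_sum (f := fun u : Fin (n₀ + 0) => (deg G₀ x u 0 : ℝ))
    (fun u _ => by positivity) (Finset.mem_univ _))

/-- Every new edge has two endpoints. That the total is deterministic allows the random rates to be
compared with a fixed harmonic-type sum. -/
theorem sum_typeDeg (n : ℕ) :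
    ∑ l, typeDeg G₀ attr₀ x n l = baseDeg G₀ attr₀ x + 2 * n := by
  induction n with
  | zero => simp [baseDeg]
  | succ n ih =>
    simp only [typeDeg_succ G₀ attr₀ x, Finset.sum_add_distrib, ih]
    simp
    ring

end Network

end AttributedPA

namespace AttributedPA

/-! ### Functions of finite histories and the one-step averaging formula. -/

section Model

variable {K n₀ : ℕ} {π : Fin K → ℝ} {κ : Fin K → Fin K → ℝ} {G₀ : SimpleGraph (Fin n₀)}
  {attr₀ : Fin n₀ → Fin K} {Ω : Type*}
  {X : (n : ℕ) → Ω → Fin K × Fin (n₀ + n)}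

/-- The evolution that is realised at `ω`. -/
abbrev evo (X : (n : ℕ) → Ω → Fin K × Fin (n₀ + n)) (ω : Ω) : Evolution K n₀ := fun i => X i ω

theorem measurable_domRestrict_evo (X : (n : ℕ) → Ω → Fin K × Fin (n₀ + n)) (n : ℕ) :
    Measurable[networkSigma X n] fun ω => (Set.Iio n).domRestrict (evo X ω) := by
  refine @measurable_pi_lambda _ _ _ (networkSigma X n) _ _ fun i => ?_
  have hi : (i : ℕ) ∈ Finset.range n := Finset.mem_range.2 i.2
  refine Measurable.mono (comap_measurable (X i)) ?_ le_rfl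
  exact le_iSup₂_of_le (f := fun i (_ : i ∈ Finset.range n) =>
    MeasurableSpace.comap (X i) inferInstance) (i : ℕ) hi le_rfl

theorem networkSigma_mono (X : (n : ℕ) → Ω → Fin K × Fin (n₀ + n)) : Monotone (networkSigma X) :=
  fun _ _ h => biSup_mono fun _ hi => Finset.mem_range.2 ((Finset.mem_range.1 hi).trans_le h)

/-- There are finitely many histories before time `n`, so a function of the history is automatically
measurable and, as the next lemma shows, bounded. No integrability needs to be proved by hand later.
-/
theorem _root_.DependsOn.measurable_evo {f : Evolution K n₀ → ℝ} {n : ℕ}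
    (hf : DependsOn f (Set.Iio n)) : Measurable[networkSigma X n] fun ω => f (evo X ω) := by
  obtain ⟨g, rfl⟩ := dependsOn_iff_exists_comp.1 hf
  exact (measurable_of_countable g).comp (measurable_domRestrict_evo X n)

theorem _root_.DependsOn.exists_abs_le {f : Evolution K n₀ → ℝ} {n : ℕ}
    (hf : DependsOn f (Set.Iio n)) : ∃ B, ∀ x, |f x| ≤ B := by
  obtain ⟨g, rfl⟩ := dependsOn_iff_exists_comp.1 hf
  exact ⟨∑ h, |g h|, fun x => Finset.single_le_sum (f := fun h => |g h|)
    (fun _ _ => abs_nonneg _) (Finset.mem_univ _)⟩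

/-- The converse direction for events: it lets the set integrals in the submartingale property be
written with weights that depend on the history. -/
theorem exists_preimage_evo {n : ℕ} {s : Set Ω} (hs : MeasurableSet[networkSigma X n] s) :
    ∃ S : Set (Evolution K n₀), s = {ω | evo X ω ∈ S} ∧
      DependsOn (S.indicator (1 : Evolution K n₀ → ℝ)) (Set.Iio n) := by
  have hle : networkSigma X n ≤
      MeasurableSpace.comap (fun ω => (Set.Iio n).domRestrict (evo X ω)) inferInstance := by
    refine iSup₂_le fun i hi => ?_
    rw [← measurable_iff_comap_le]
    exact (measurable_pi_apply (X := fun i : Set.Iio n => Fin K × Fin (n₀ + (i : ℕ)))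
      ⟨i, Finset.mem_range.1 hi⟩).comp (comap_measurable _)
  obtain ⟨T, -, rfl⟩ := hle s hs
  refine ⟨(Set.Iio n).domRestrict ⁻¹' T, rfl, fun x y h => ?_⟩
  have hxy : (Set.Iio n).domRestrict x = (Set.Iio n).domRestrict y := funext fun i => h i i.2
  have hiff : x ∈ (Set.Iio n).domRestrict ⁻¹' T ↔ y ∈ (Set.Iio n).domRestrict ⁻¹' T := by
    change _ ∈ T ↔ _ ∈ T
    rw [hxy]
  by_cases hx : x ∈ (Set.Iio n).domRestrict ⁻¹' T
  · rw [Set.indicator_of_mem hx, Set.indicator_of_mem (hiff.1 hx)]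
    rfl
  · rw [Set.indicator_of_notMem hx, Set.indicator_of_notMem fun h' => hx (hiff.2 h')]

variable [mΩ : MeasurableSpace Ω] {μ : Measure Ω}

theorem networkSigma_le (hX : ∀ n, Measurable (X n)) (n : ℕ) : networkSigma X n ≤ mΩ :=
  iSup₂_le fun i _ => (hX i).comap_le

theorem _root_.DependsOn.memLp_evo [IsFiniteMeasure μ] (hX : ∀ n, Measurable (X n))
    {f : Evolution K n₀ → ℝ} {n : ℕ} (hf : DependsOn f (Set.Iio n)) (p : ENNReal) :
    MemLp (fun ω => f (evo X ω)) p μ := by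
  obtain ⟨B, hB⟩ := hf.exists_abs_le
  exact MemLp.of_bound (hf.measurable_evo.mono (networkSigma_le hX n) le_rfl).aestronglyMeasurable
    B (ae_of_all _ fun ω => hB _)

theorem _root_.DependsOn.integrable_evo [IsFiniteMeasure μ] (hX : ∀ n, Measurable (X n))
    {f : Evolution K n₀ → ℝ} {n : ℕ} (hf : DependsOn f (Set.Iio n)) :
    Integrable (fun ω => f (evo X ω)) μ :=
  memLp_one_iff_integrable.1 (hf.memLp_evo hX 1)

/-- The probability, given the network at time `n`, that `v_{n+1}` has the attribute `q.1` and
attaches to `q.2`. -/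
noncomputable def stepProb (π : Fin K → ℝ) (κ : Fin K → Fin K → ℝ) (G₀ : SimpleGraph (Fin n₀))
    (attr₀ : Fin n₀ → Fin K) (x : Evolution K n₀) (n : ℕ) (q : Fin K × Fin (n₀ + n)) : ℝ :=
  π q.1 * attachProb G₀ attr₀ x κ n q.1 q.2

theorem IsModelP.step_law (hX : IsModelP π κ G₀ attr₀ μ X) (n : ℕ) (x : Evolution K n₀)
    (q : Fin K × Fin (n₀ + n)) :
    μ.real {ω | (∀ i < n, X i ω = x i) ∧ X n ω = q} =
      stepProb π κ G₀ attr₀ x n q * μ.real {ω | ∀ i < n, X i ω = x i} := by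
  rw [show q = (q.1, q.2) from rfl, hX.attach_law, hX.attribute_law, stepProb]
  ring

theorem attachProb_congr {x y : Evolution K n₀} {n : ℕ} (h : ∀ i < n, x i = y i) (b : Fin K)
    (v : Fin (n₀ + n)) : attachProb G₀ attr₀ x κ n b v = attachProb G₀ attr₀ y κ n b v := by
  unfold attachProb
  simp only [deg_congr G₀ h, fun u : Fin (n₀ + n) => attrOf_congr attr₀ h u.isLt]

theorem stepProb_congr {x y : Evolution K n₀} {n : ℕ} (h : ∀ i < n, x i = y i)
    (q : Fin K × Fin (n₀ + n)) : stepProb π κ G₀ attr₀ x n q = stepProb π κ G₀ attr₀ y n q := by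
  rw [stepProb, stepProb, attachProb_congr h]

/-- Averaging over the step from time `n` to time `n + 1`. -/
theorem IsModelP.integral_step [IsProbabilityMeasure μ] (hX : IsModelP π κ G₀ attr₀ μ X) {n : ℕ}
    {f : Evolution K n₀ → Fin K × Fin (n₀ + n) → ℝ}
    (hf : ∀ q, DependsOn (fun x => f x q) (Set.Iio n)) :
    ∫ ω, f (evo X ω) (X n ω) ∂μ =
      ∫ ω, ∑ q, stepProb π κ G₀ attr₀ (evo X ω) n q * f (evo X ω) q ∂μ := by
  choose g hg using fun q => dependsOn_iff_exists_comp.1 (hf q)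
  have hg' : ∀ x q, f x q = g q ((Set.Iio n).domRestrict x) := fun x q => congrFun (hg q) x
  have hs : ∀ q, DependsOn (fun x => stepProb π κ G₀ attr₀ x n q) (Set.Iio n) :=
    fun q x y h => stepProb_congr h q
  choose p hp using fun q => dependsOn_iff_exists_comp.1 (hs q)
  have hp' : ∀ x q, stepProb π κ G₀ attr₀ x n q = p q ((Set.Iio n).domRestrict x) :=
    fun x q => congrFun (hp q) x
  have hR : Measurable fun ω => (Set.Iio n).domRestrict (evo X ω) :=
    (measurable_domRestrict_evo X n).mono (networkSigma_le hX.measurable n) le_rfl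
  have hT : Measurable fun ω => ((Set.Iio n).domRestrict (evo X ω), X n ω) :=
    hR.prodMk (hX.measurable n)
  have e1 : ∫ ω, f (evo X ω) (X n ω) ∂μ =
      ∫ t, g t.2 t.1 ∂(μ.map fun ω => ((Set.Iio n).domRestrict (evo X ω), X n ω)) := by
    rw [integral_map hT.aemeasurable (measurable_of_countable _).aestronglyMeasurable]
    simp only [hg']
  have e2 : ∫ ω, ∑ q, stepProb π κ G₀ attr₀ (evo X ω) n q * f (evo X ω) q ∂μ =
      ∫ t, ∑ q, p q t * g q t ∂(μ.map fun ω => (Set.Iio n).domRestrict (evo X ω)) := by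
    rw [integral_map hR.aemeasurable (measurable_of_countable _).aestronglyMeasurable]
    simp only [hg', hp']
  -- Both laws now live on finite spaces, so the two sides are finite sums and are compared atom by
  -- atom.
  rw [e1, e2, integral_fintype Integrable.of_finite, integral_fintype Integrable.of_finite,
    Fintype.sum_prod_type]
  refine Finset.sum_congr rfl fun h _ => ?_
  rw [smul_eq_mul, Finset.mul_sum]
  refine Finset.sum_congr rfl fun q _ => ?_
  have m1 : (μ.map fun ω => ((Set.Iio n).domRestrict (evo X ω), X n ω)).real {(h, q)} =
      μ.real {ω | (Set.Iio n).domRestrict (evo X ω) = h ∧ X n ω = q} := by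
    rw [measureReal_def, Measure.map_apply hT (measurableSet_singleton _), measureReal_def]
    congr 2
    ext ω
    simp [Prod.ext_iff]
  have m2 : (μ.map fun ω => (Set.Iio n).domRestrict (evo X ω)).real {h} =
      μ.real {ω | (Set.Iio n).domRestrict (evo X ω) = h} := by
    rw [measureReal_def, Measure.map_apply hR (measurableSet_singleton _), measureReal_def]
    rfl
  have hΩ : Nonempty Ω := nonempty_of_isProbabilityMeasure μ
  -- The step law speaks of full evolutions; the continuation after time `n` is irrelevant and is
  -- taken from an arbitrary sample point.
  let x : Evolution K n₀ := fun i => if hi : i < n then h ⟨i, hi⟩ else X i hΩ.some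
  have hx : (Set.Iio n).domRestrict x = h := funext fun i => dif_pos i.2
  have hiff : ∀ ω, (Set.Iio n).domRestrict (evo X ω) = h ↔ ∀ i < n, X i ω = x i := by
    intro ω
    rw [← hx]
    simp [funext_iff, Set.domRestrict]
  rw [m1, m2]
  simp only [hiff]
  rw [hX.step_law, hp', hx, smul_eq_mul]
  ring

end Model

end AttributedPA

namespace AttributedPA

/-! ### Existence of the minimizer and the inequality that it provides. -/

section Minimizer

variable {K : ℕ} {π : Fin K → ℝ} {κ : Fin K → Fin K → ℝ}

theorem kernel_sum_pos (hκ : ∀ a b, 0 < κ a b) {y : Fin K → ℝ} (hy : ∀ a, 0 < y a) (b : Fin K) :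
    0 < ∑ k, κ k b * y k :=
  Finset.sum_pos (fun k _ => mul_pos (hκ k b) (hy k)) ⟨b, Finset.mem_univ b⟩

/-- Minimising the potential amounts to maximising `f = exp (2 - 2 V)`. As a product of powers, `f`
is continuous on the closed simplex and vanishes on its boundary because all weights are positive,
so a maximum point over the compact simplex is interior. -/
theorem exists_minimizer [NeZero K] (hπ : ∀ a, 0 < π a) (hκ : ∀ a b, 0 < κ a b) :
    ∃ η ∈ simplexInterior K, ∀ y ∈ simplexInterior K, potential π κ η ≤ potential π κ y := by
  let f : (Fin K → ℝ) → ℝ := fun y => ∏ j, y j ^ π j * (∑ k, y k * κ k j) ^ π j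
  have hf : Continuous f := by
    refine continuous_finsetProd _ fun j _ => Continuous.mul ?_ ?_
    · exact (continuous_apply j).rpow_const fun _ => Or.inr (hπ j).le
    · refine Continuous.rpow_const ?_ fun _ => Or.inr (hπ j).le
      fun_prop
  have hT : ∀ y : Fin K → ℝ, (∀ a, 0 < y a) → ∀ j, 0 < ∑ k, y k * κ k j := fun y hy j => by
    simpa only [mul_comm] using kernel_sum_pos hκ hy j
  have hlog : ∀ y : Fin K → ℝ, (∀ a, 0 < y a) →
      potential π κ y = 1 - 1 / 2 * Real.log (f y) := fun y hy => by
    have : ∀ j, y j ^ π j * (∑ k, y k * κ k j) ^ π j ≠ 0 := fun j =>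
      (mul_pos (Real.rpow_pos_of_pos (hy j) _) (Real.rpow_pos_of_pos (hT y hy j) _)).ne'
    simp only [f]
    rw [potential, Real.log_prod fun j _ => this j]
    congr 2
    refine Finset.sum_congr rfl fun j _ => ?_
    rw [Real.log_mul (Real.rpow_pos_of_pos (hy j) _).ne'
      (Real.rpow_pos_of_pos (hT y hy j) _).ne', Real.log_rpow (hy j), Real.log_rpow (hT y hy j)]
    ring
  have hpos : ∀ y : Fin K → ℝ, (∀ a, 0 < y a) → 0 < f y := fun y hy =>
    Finset.prod_pos fun j _ =>
      mul_pos (Real.rpow_pos_of_pos (hy j) _) (Real.rpow_pos_of_pos (hT y hy j) _)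
  have hK : (0 : ℝ) < K := by exact_mod_cast NeZero.pos K
  let c : Fin K → ℝ := fun _ => 1 / K
  have hc : ∀ a, 0 < c a := fun a => by positivity
  have hc1 : ∑ a, c a = 1 := by simp [c, hK.ne']
  obtain ⟨η, hη, hmax⟩ := (isCompact_stdSimplex ℝ (Fin K)).exists_isMaxOn
    ⟨c, fun a => (hc a).le, hc1⟩ hf.continuousOn
  have hfη : 0 < f η := (hpos c hc).trans_le (hmax ⟨fun a => (hc a).le, hc1⟩)
  have hη0 : ∀ a, 0 < η a := fun a => by
    refine lt_of_le_of_ne (hη.1 a) fun h => hfη.ne' ?_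
    refine Finset.prod_eq_zero (Finset.mem_univ a) ?_
    rw [← h, Real.zero_rpow (hπ a).ne', zero_mul]
  refine ⟨η, ⟨hη0, hη.2⟩, fun y hy => ?_⟩
  rw [hlog η hη0, hlog y hy.1]
  have := Real.log_le_log (hpos y hy.1) (hmax ⟨fun a => (hy.1 a).le, hy.2⟩)
  linarith

theorem minimizer_spec [NeZero K] (hπ : ∀ a, 0 < π a) (hκ : ∀ a b, 0 < κ a b) :
    minimizer π κ ∈ simplexInterior K ∧
      ∀ y ∈ simplexInterior K, potential π κ (minimizer π κ) ≤ potential π κ y :=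
  Classical.epsilon_spec (exists_minimizer hπ hκ)

theorem le_one_of_mem_simplexInterior {y : Fin K → ℝ} (hy : y ∈ simplexInterior K) (a : Fin K) :
    y a ≤ 1 :=
  hy.2 ▸ Finset.single_le_sum (fun b _ => (hy.1 b).le) (Finset.mem_univ a)

/-- This is `log x ≤ x - 1` with a quadratic surplus. With `x = √(u / w)`, `x ^ 2 = 1 + 2 (x - 1) +
(x - 1) ^ 2 ≥ 1 + 2 log x + (x - 1) ^ 2`, and the last square dominates `(u - w) ^ 2 / 4` because
both numbers are at most one. -/
theorem one_add_log_div_le {u w : ℝ} (hu : 0 < u) (hu1 : u ≤ 1) (hw : 0 < w) (hw1 : w ≤ 1) :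
    1 + (Real.log u - Real.log w) + (u - w) ^ 2 / 4 ≤ u / w := by
  obtain ⟨s, hs, rfl⟩ : ∃ s, 0 < s ∧ u = s ^ 2 := ⟨√u, Real.sqrt_pos.2 hu, (Real.sq_sqrt hu.le).symm⟩
  obtain ⟨t, ht, rfl⟩ : ∃ t, 0 < t ∧ w = t ^ 2 := ⟨√w, Real.sqrt_pos.2 hw, (Real.sq_sqrt hw.le).symm⟩
  have hs1 : s ≤ 1 := by nlinarith
  have ht1 : t ≤ 1 := by nlinarith
  have h1 := Real.log_le_sub_one_of_pos (div_pos hs ht)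
  rw [Real.log_div hs.ne' ht.ne'] at h1
  have h2 : (s ^ 2 - t ^ 2) ^ 2 / 4 ≤ (s / t - 1) ^ 2 := by
    have e1 : s / t - 1 = (s - t) / t := by field_simp
    have e2 : (s ^ 2 - t ^ 2) ^ 2 / 4 = ((s - t) ^ 2) * ((s + t) / 2) ^ 2 := by ring
    rw [e1, e2, div_pow (s - t) t]
    have h3 : ((s + t) / 2) ^ 2 ≤ 1 := by nlinarith
    have h4 : (s - t) ^ 2 ≤ (s - t) ^ 2 / t ^ 2 :=
      le_div_self (sq_nonneg _) (by positivity) (by nlinarith)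
    exact (mul_le_of_le_one_right (sq_nonneg _) h3).trans h4
  rw [Real.log_pow, Real.log_pow, ← div_pow]
  push_cast
  nlinarith

/-- The quantity that controls the decay of the Lyapunov function. -/
theorem two_add_le_of_minimizer [NeZero K] (hπ : ∀ a, 0 < π a) (hπ1 : ∑ a, π a = 1)
    (hκ : ∀ a b, 0 < κ a b) {y : Fin K → ℝ} (hy : y ∈ simplexInterior K) :
    2 + ∑ l, π l * ((minimizer π κ l - y l) ^ 2 / 4) ≤
      ∑ l, minimizer π κ l * (π l / y l + ∑ b, π b * κ l b / ∑ k, κ k b * y k) := by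
  obtain ⟨hη, hmin⟩ := minimizer_spec hπ hκ
  set η := minimizer π κ
  have hV := hmin y hy
  simp only [potential, mul_comm (y _) (κ _ _), mul_comm (η _) (κ _ _)] at hV
  -- Exchanging the sums produces ratios of the same two expressions at `η` and at `y`, to which the
  -- logarithmic inequalities apply.
  have e : ∑ l, η l * (π l / y l + ∑ b, π b * κ l b / ∑ k, κ k b * y k) =
      ∑ b, π b * (η b / y b + (∑ k, κ k b * η k) / ∑ k, κ k b * y k) := by
    simp only [mul_add, Finset.sum_add_distrib, Finset.mul_sum, Finset.sum_div]
    congr 1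
    · exact Finset.sum_congr rfl fun l _ => by ring
    · rw [Finset.sum_comm]
      exact Finset.sum_congr rfl fun l _ => Finset.sum_congr rfl fun b _ => by ring
  rw [e]
  have h1 : ∀ b, π b * (2 + ((Real.log (η b) + Real.log (∑ k, κ k b * η k)) -
        (Real.log (y b) + Real.log (∑ k, κ k b * y k))) + (η b - y b) ^ 2 / 4) ≤
      π b * (η b / y b + (∑ k, κ k b * η k) / ∑ k, κ k b * y k) := fun b => by
    refine mul_le_mul_of_nonneg_left ?_ (hπ b).le
    have h2 := one_add_log_div_le (hη.1 b) (le_one_of_mem_simplexInterior hη b) (hy.1 b)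
      (le_one_of_mem_simplexInterior hy b)
    have h3 := Real.log_le_sub_one_of_pos
      (div_pos (kernel_sum_pos hκ hη.1 b) (kernel_sum_pos hκ hy.1 b))
    rw [Real.log_div (kernel_sum_pos hκ hη.1 b).ne' (kernel_sum_pos hκ hy.1 b).ne'] at h3
    linarith
  -- The logarithms add up to twice the potential at `y` minus twice the potential at `η`, which is
  -- non-negative by minimality. No critical-point equation is needed.
  refine le_trans ?_ (Finset.sum_le_sum fun b _ => h1 b)
  simp only [mul_add, mul_sub, Finset.sum_add_distrib, Finset.sum_sub_distrib] at hV ⊢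
  rw [← Finset.sum_mul, hπ1]
  linarith

end Minimizer

end AttributedPA

namespace AttributedPA

/-! ### Homogeneity, bounds and Lipschitz dependence of the attachment rates. -/

section Rate

variable {K : ℕ} {π : Fin K → ℝ} {κ : Fin K → Fin K → ℝ}

/-- The rate `∑_b π_b κ_{l,b} / ∑_k κ_{k,b} y_k`. -/
noncomputable def rate (π : Fin K → ℝ) (κ : Fin K → Fin K → ℝ) (y : Fin K → ℝ) (l : Fin K) : ℝ :=
  ∑ b, π b * κ l b / ∑ k, κ k b * y k

theorem phi_eq_rate (a : Fin K) : phi π κ a = rate π κ (minimizer π κ) a :=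
  Finset.sum_congr rfl fun b _ => by rw [resolvingWeight]; ring

theorem rate_smul {c : ℝ} (y : Fin K → ℝ) (l : Fin K) :
    rate π κ (fun k => c * y k) l = rate π κ y l / c := by
  rw [rate, rate, Finset.sum_div]
  refine Finset.sum_congr rfl fun b _ => ?_
  rw [div_div, Finset.sum_mul]
  exact congrArg _ (Finset.sum_congr rfl fun k _ => by ring)

variable {k₀ k₁ : ℝ}

theorem exists_kernel_bounds [NeZero K] (hκ : ∀ a b, 0 < κ a b) :
    ∃ k₀ k₁ : ℝ, 0 < k₀ ∧ k₀ ≤ k₁ ∧ (∀ a b, k₀ ≤ κ a b) ∧ ∀ a b, κ a b ≤ k₁ := by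
  have hne : (Finset.univ : Finset (Fin K × Fin K)).Nonempty := ⟨(0, 0), Finset.mem_univ _⟩
  obtain ⟨p, -, hp⟩ := Finset.exists_min_image Finset.univ (fun p : Fin K × Fin K => κ p.1 p.2) hne
  obtain ⟨q, -, hq⟩ := Finset.exists_max_image Finset.univ (fun p : Fin K × Fin K => κ p.1 p.2) hne
  exact ⟨κ p.1 p.2, κ q.1 q.2, hκ _ _, hp q (Finset.mem_univ _),
    fun a b => hp (a, b) (Finset.mem_univ _), fun a b => hq (a, b) (Finset.mem_univ _)⟩

theorem mul_sum_le_kernel_sum (hk : ∀ a b, k₀ ≤ κ a b) {y : Fin K → ℝ} (hy : ∀ k, 0 ≤ y k)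
    (b : Fin K) : k₀ * ∑ k, y k ≤ ∑ k, κ k b * y k := by
  rw [Finset.mul_sum]
  exact Finset.sum_le_sum fun k _ => mul_le_mul_of_nonneg_right (hk k b) (hy k)

theorem kernel_sum_le_mul_sum (hk : ∀ a b, κ a b ≤ k₁) {y : Fin K → ℝ} (hy : ∀ k, 0 ≤ y k)
    (b : Fin K) : ∑ k, κ k b * y k ≤ k₁ * ∑ k, y k := by
  rw [Finset.mul_sum]
  exact Finset.sum_le_sum fun k _ => mul_le_mul_of_nonneg_right (hk k b) (hy k)

theorem rate_le (hπ : ∀ a, 0 < π a) (hπ1 : ∑ a, π a = 1) (hk₀ : 0 < k₀)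
    (hk : ∀ a b, k₀ ≤ κ a b) (hk' : ∀ a b, κ a b ≤ k₁) {y : Fin K → ℝ} (hy : ∀ k, 0 ≤ y k)
    (hs : 0 < ∑ k, y k) (l : Fin K) : rate π κ y l ≤ k₁ / k₀ / ∑ k, y k := by
  have : ∀ b, π b * κ l b / ∑ k, κ k b * y k ≤ π b * (k₁ / k₀ / ∑ k, y k) := fun b => by
    rw [mul_div_assoc, div_div]
    exact mul_le_mul_of_nonneg_left (div_le_div₀ (hk₀.le.trans ((hk l b).trans (hk' l b)))
      (hk' l b) (by positivity) (mul_sum_le_kernel_sum hk hy b)) (hπ b).le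
  refine (Finset.sum_le_sum fun b _ => this b).trans_eq ?_
  rw [← Finset.sum_mul, hπ1, one_mul]

theorem le_rate (hπ : ∀ a, 0 < π a) (hπ1 : ∑ a, π a = 1) (hk₀ : 0 < k₀)
    (hk : ∀ a b, k₀ ≤ κ a b) (hk' : ∀ a b, κ a b ≤ k₁) {y : Fin K → ℝ} (hy : ∀ k, 0 ≤ y k)
    (hs : 0 < ∑ k, y k) (l : Fin K) : k₀ / k₁ / ∑ k, y k ≤ rate π κ y l := by
  have : ∀ b, π b * (k₀ / k₁ / ∑ k, y k) ≤ π b * κ l b / ∑ k, κ k b * y k := fun b => by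
    rw [mul_div_assoc, div_div]
    exact mul_le_mul_of_nonneg_left (div_le_div₀ (hk₀.le.trans (hk l b))
      (hk l b) ((mul_pos hk₀ hs).trans_le (mul_sum_le_kernel_sum hk hy b))
      (kernel_sum_le_mul_sum hk' hy b)) (hπ b).le
  refine le_trans (Eq.le ?_) (Finset.sum_le_sum fun b _ => this b)
  rw [← Finset.sum_mul, hπ1, one_mul]

theorem rate_nonneg (hπ : ∀ a, 0 < π a) (hκ : ∀ a b, 0 < κ a b) {y : Fin K → ℝ}
    (hy : ∀ k, 0 ≤ y k) (l : Fin K) : 0 ≤ rate π κ y l :=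
  Finset.sum_nonneg fun b _ => div_nonneg (mul_pos (hπ b) (hκ l b)).le
    (Finset.sum_nonneg fun k _ => mul_nonneg (hκ k b).le (hy k))

/-- The rate depends on its argument in a Lipschitz way. -/
theorem abs_rate_sub_rate_le (hπ : ∀ a, 0 < π a) (hπ1 : ∑ a, π a = 1) (hk₀ : 0 < k₀)
    (hk : ∀ a b, k₀ ≤ κ a b) (hk' : ∀ a b, κ a b ≤ k₁) {y z : Fin K → ℝ} (hy : ∀ k, 0 ≤ y k)
    (hz : ∀ k, 0 ≤ z k) (hsy : 0 < ∑ k, y k) (hsz : 0 < ∑ k, z k) (l : Fin K) :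
    |rate π κ y l - rate π κ z l| ≤
      (k₁ / k₀) ^ 2 * (∑ k, |z k - y k|) / ((∑ k, y k) * ∑ k, z k) := by
  rw [rate, rate, ← Finset.sum_sub_distrib]
  refine (Finset.abs_sum_le_sum_abs _ _).trans ?_
  have hk₁ : ∀ b, 0 ≤ k₁ := fun b => hk₀.le.trans ((hk l b).trans (hk' l b))
  have key : ∀ b, |π b * κ l b / ∑ k, κ k b * y k - π b * κ l b / ∑ k, κ k b * z k| ≤
      π b * ((k₁ / k₀) ^ 2 * (∑ k, |z k - y k|) / ((∑ k, y k) * ∑ k, z k)) := fun b => by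
    have hY := mul_sum_le_kernel_sum hk hy b
    have hZ := mul_sum_le_kernel_sum hk hz b
    have hY0 := (mul_pos hk₀ hsy).trans_le hY
    have hZ0 := (mul_pos hk₀ hsz).trans_le hZ
    have e : π b * κ l b / ∑ k, κ k b * y k - π b * κ l b / ∑ k, κ k b * z k =
        π b * (κ l b * (∑ k, κ k b * (z k - y k)) /
          ((∑ k, κ k b * y k) * ∑ k, κ k b * z k)) := by
      simp only [mul_sub, Finset.sum_sub_distrib]
      field_simp
    have hnum : |∑ k, κ k b * (z k - y k)| ≤ k₁ * ∑ k, |z k - y k| := by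
      refine (Finset.abs_sum_le_sum_abs _ _).trans ?_
      rw [Finset.mul_sum]
      refine Finset.sum_le_sum fun k _ => ?_
      rw [abs_mul, abs_of_pos (hk₀.trans_le (hk k b))]
      exact mul_le_mul_of_nonneg_right (hk' k b) (abs_nonneg _)
    rw [e, abs_mul, abs_of_pos (hπ b), abs_div, abs_mul, abs_of_pos (hk₀.trans_le (hk l b)),
      abs_of_pos (mul_pos hY0 hZ0)]
    refine mul_le_mul_of_nonneg_left ?_ (hπ b).le
    have e' : (k₁ / k₀) ^ 2 * (∑ k, |z k - y k|) / ((∑ k, y k) * ∑ k, z k) =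
        (k₁ * (k₁ * ∑ k, |z k - y k|)) / ((k₀ * ∑ k, y k) * (k₀ * ∑ k, z k)) := by
      field_simp
    rw [e']
    have h0 : 0 ≤ ∑ k, |z k - y k| := Finset.sum_nonneg fun k _ => abs_nonneg _
    exact div_le_div₀ (mul_nonneg (hk₁ b) (mul_nonneg (hk₁ b) h0))
      (mul_le_mul (hk' l b) hnum (abs_nonneg _) (hk₁ b)) (by positivity)
      (mul_le_mul hY hZ (by positivity) hY0.le)
  refine (Finset.sum_le_sum fun b _ => key b).trans_eq ?_
  rw [← Finset.sum_mul, hπ1, one_mul]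

end Rate

/-! ### Conditional means over one step. -/

section Step

variable {K n₀ : ℕ} {π : Fin K → ℝ} {κ : Fin K → Fin K → ℝ} {G₀ : SimpleGraph (Fin n₀)}
  {attr₀ : Fin n₀ → Fin K}

theorem kernel_sum_typeDeg (x : Evolution K n₀) (n : ℕ) (b : Fin K) :
    ∑ k, κ k b * typeDeg G₀ attr₀ x n k =
      ∑ u : Fin (n₀ + n), κ (attrOf attr₀ x u) b * (deg G₀ x u n : ℝ) :=
  sum_mul_typeDeg G₀ attr₀ x n fun k => κ k b

theorem sum_typeDeg_pos (hG₀ : G₀.Connected) (x : Evolution K n₀) (n : ℕ) :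
    0 < ∑ k, typeDeg G₀ attr₀ x n k := by
  have := one_le_baseDeg G₀ attr₀ x hG₀
  rw [sum_typeDeg]
  positivity

theorem kernel_sum_typeDeg_pos (hκ : ∀ a b, 0 < κ a b) (hG₀ : G₀.Connected) (x : Evolution K n₀)
    (n : ℕ) (b : Fin K) : 0 < ∑ k, κ k b * typeDeg G₀ attr₀ x n k := by
  refine lt_of_le_of_ne (Finset.sum_nonneg fun k _ =>
    mul_nonneg (hκ k b).le (typeDeg_nonneg G₀ attr₀ x n k)) fun h => ?_
  rw [eq_comm, Finset.sum_eq_zero_iff_of_nonneg fun k _ =>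
    mul_nonneg (hκ k b).le (typeDeg_nonneg G₀ attr₀ x n k)] at h
  refine (sum_typeDeg_pos (attr₀ := attr₀) hG₀ x n).ne' (Finset.sum_eq_zero fun k hk => ?_)
  exact (mul_eq_zero.1 (h k hk)).resolve_left (hκ k b).ne'

theorem attachProb_eq (x : Evolution K n₀) (n : ℕ) (b : Fin K) (v : Fin (n₀ + n)) :
    attachProb G₀ attr₀ x κ n b v = (κ (attrOf attr₀ x v) b * (deg G₀ x v n : ℝ)) /
      ∑ k, κ k b * typeDeg G₀ attr₀ x n k := by
  rw [kernel_sum_typeDeg, attachProb]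

theorem stepProb_pos (hπ : ∀ a, 0 < π a) (hκ : ∀ a b, 0 < κ a b) (hG₀ : G₀.Connected)
    (x : Evolution K n₀) (n : ℕ) (q : Fin K × Fin (n₀ + n)) :
    0 < stepProb π κ G₀ attr₀ x n q := by
  have hd : 0 < deg G₀ x q.2 n := deg_pos G₀ x hG₀ q.2.isLt
  rw [stepProb, attachProb_eq]
  have := kernel_sum_typeDeg_pos (attr₀ := attr₀) hκ hG₀ x n q.1
  have := hκ (attrOf attr₀ x q.2) q.1
  have := hπ q.1
  positivity

theorem sum_stepProb_mul_fst (hκ : ∀ a b, 0 < κ a b) (hG₀ : G₀.Connected) (x : Evolution K n₀)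
    (n : ℕ) (f : Fin K → ℝ) :
    ∑ q, stepProb π κ G₀ attr₀ x n q * f q.1 = ∑ b, π b * f b := by
  rw [Fintype.sum_prod_type]
  refine Finset.sum_congr rfl fun b _ => ?_
  simp only [stepProb, attachProb_eq]
  rw [← Finset.sum_mul, ← Finset.mul_sum, ← Finset.sum_div, ← kernel_sum_typeDeg,
    div_self (kernel_sum_typeDeg_pos hκ hG₀ x n b).ne', mul_one]

theorem sum_stepProb (hπ1 : ∑ a, π a = 1) (hκ : ∀ a b, 0 < κ a b) (hG₀ : G₀.Connected)
    (x : Evolution K n₀) (n : ℕ) : ∑ q, stepProb π κ G₀ attr₀ x n q = 1 := by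
  simpa [hπ1] using sum_stepProb_mul_fst (π := π) (attr₀ := attr₀) hκ hG₀ x n fun _ => 1

/-- Summing over the attribute of the newcomer first turns the attachment probabilities into rate
times degree. -/
theorem sum_stepProb_mul_snd (x : Evolution K n₀) (n : ℕ) (f : Fin (n₀ + n) → ℝ) :
    ∑ q, stepProb π κ G₀ attr₀ x n q * f q.2 =
      ∑ v : Fin (n₀ + n),
        rate π κ (typeDeg G₀ attr₀ x n) (attrOf attr₀ x v) * (deg G₀ x v n : ℝ) * f v := by
  rw [Fintype.sum_prod_type, Finset.sum_comm]
  refine Finset.sum_congr rfl fun v _ => ?_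
  simp only [stepProb, attachProb_eq, rate, Finset.sum_mul]
  exact Finset.sum_congr rfl fun b _ => by ring

/-- The increase of the total degree of the type `l` in a step. -/
def typeIncr (attr₀ : Fin n₀ → Fin K) (x : Evolution K n₀) (n : ℕ) (q : Fin K × Fin (n₀ + n))
    (l : Fin K) : ℝ :=
  (if attrOf attr₀ x q.2 = l then 1 else 0) + (if q.1 = l then 1 else 0)

theorem typeIncr_nonneg (x : Evolution K n₀) (n : ℕ) (q : Fin K × Fin (n₀ + n)) (l : Fin K) :
    0 ≤ typeIncr attr₀ x n q l := by
  unfold typeIncr; split_ifs <;> norm_num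

theorem typeIncr_le_two (x : Evolution K n₀) (n : ℕ) (q : Fin K × Fin (n₀ + n)) (l : Fin K) :
    typeIncr attr₀ x n q l ≤ 2 := by
  unfold typeIncr; split_ifs <;> norm_num

theorem sum_stepProb_mul_typeIncr (hκ : ∀ a b, 0 < κ a b) (hG₀ : G₀.Connected)
    (x : Evolution K n₀) (n : ℕ) (l : Fin K) :
    ∑ q, stepProb π κ G₀ attr₀ x n q * typeIncr attr₀ x n q l =
      π l + rate π κ (typeDeg G₀ attr₀ x n) l * typeDeg G₀ attr₀ x n l := by
  simp only [typeIncr, mul_add, Finset.sum_add_distrib]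
  rw [sum_stepProb_mul_fst hκ hG₀ x n fun b => if b = l then 1 else 0,
    sum_stepProb_mul_snd x n fun v => if attrOf attr₀ x v = l then 1 else 0, add_comm]
  congr 1
  · simp
  · rw [typeDeg, Finset.mul_sum]
    refine Finset.sum_congr rfl fun v _ => ?_
    split_ifs with h
    · rw [h]; ring
    · ring

end Step

end AttributedPA

namespace AttributedPA

/-! ### The Lyapunov function and its drift. -/

section Lyapunov

variable {K n₀ : ℕ} {π : Fin K → ℝ} {κ : Fin K → Fin K → ℝ} {G₀ : SimpleGraph (Fin n₀)}
  {attr₀ : Fin n₀ → Fin K}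

theorem add_sum_le_sub_sum {ι : Type*} [Fintype ι] {p f g : ι → ℝ} {c L : ℝ} (hp : ∀ i, 0 ≤ p i)
    (hp1 : ∑ i, p i = 1) (h : ∀ i, c + f i ≤ L - g i) :
    c + ∑ i, p i * f i ≤ L - ∑ i, p i * g i := by
  have := Finset.sum_le_sum fun i (_ : i ∈ Finset.univ) => mul_le_mul_of_nonneg_left (h i) (hp i)
  simp only [mul_add, mul_sub, Finset.sum_add_distrib, Finset.sum_sub_distrib] at this
  rwa [← Finset.sum_mul, ← Finset.sum_mul, hp1, one_mul, one_mul] at this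

/-- The logarithm grows by at least `d / (z + d)` instead of the wanted `d / z`, and the drop of a
multiple of `1 / z` pays the difference. The `2` covers this concavity loss since `d ≤ 2`; the `3 /
p` yields the extra `d / (p * z ^ 2)` since `z + d ≤ 3 * z`. That extra term later offsets the shift
of the degrees by one. -/
theorem log_add_sub_log_ge {z d p : ℝ} (hz : 1 ≤ z) (hd : 0 ≤ d) (hd2 : d ≤ 2) (hp : 0 < p) :
    d * (1 / z + 1 / (p * z ^ 2)) ≤
      Real.log (z + d) - Real.log z + (2 + 3 / p) * (1 / z - 1 / (z + d)) := by
  have hz0 : 0 < z := by linarith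
  have hzd : 0 < z + d := by linarith
  have h1 : d / (z + d) ≤ Real.log (z + d) - Real.log z := by
    have := Real.one_sub_inv_le_log_of_pos (div_pos hzd hz0)
    rw [Real.log_div hzd.ne' hz0.ne'] at this
    refine le_trans (Eq.le ?_) this
    field_simp
    ring
  have h2 : 1 / z - 1 / (z + d) = d / (z * (z + d)) := by field_simp; ring
  have h3 : d / z ≤ d / (z + d) + 2 * (d / (z * (z + d))) := by
    have : d / (z + d) + 2 * (d / (z * (z + d))) = d * (z + 2) / (z * (z + d)) := by
      field_simp
    rw [this, div_le_div_iff₀ hz0 (by positivity)]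
    nlinarith [mul_nonneg (mul_nonneg hd hz0.le) (sub_nonneg.2 hd2)]
  have h4 : d / (p * z ^ 2) ≤ 3 / p * (d / (z * (z + d))) := by
    rw [div_mul_div_comm, div_le_div_iff₀ (by positivity) (by positivity)]
    have : 0 ≤ d * p * z * (2 * z - d) := by
      have : 0 ≤ 2 * z - d := by linarith
      positivity
    nlinarith
  have e : d * (1 / z + 1 / (p * z ^ 2)) = d / z + d / (p * z ^ 2) := by ring
  rw [e, h2, add_mul]
  linarith

/-- The Lyapunov function of the vector of the total degrees of the types. -/
noncomputable def lyap (π η z : Fin K → ℝ) : ℝ :=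
  Real.log (∑ l, z l) - ∑ l, η l * Real.log (z l) + ∑ l, η l * ((2 + 3 / π l) * (1 / z l))

/-- The weighted squared distance of the normalised vector from `η`. -/
noncomputable def sqDist (π η z : Fin K → ℝ) : ℝ :=
  ∑ l, π l * ((η l - z l / ∑ k, z k) ^ 2 / 4)

theorem sqDist_nonneg {η z : Fin K → ℝ} (hπ : ∀ a, 0 < π a) : 0 ≤ sqDist π η z :=
  Finset.sum_nonneg fun l _ => mul_nonneg (hπ l).le (by positivity)

theorem lyap_nonneg {η z : Fin K → ℝ} (hπ : ∀ a, 0 < π a) (hη : η ∈ simplexInterior K)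
    (hz : ∀ l, 0 < z l) : 0 ≤ lyap π η z := by
  have h1 : ∑ l, η l * Real.log (z l) ≤ Real.log (∑ l, z l) := by
    calc ∑ l, η l * Real.log (z l) ≤ ∑ l, η l * Real.log (∑ l, z l) :=
          Finset.sum_le_sum fun l _ => mul_le_mul_of_nonneg_left (Real.log_le_log (hz l)
            (Finset.single_le_sum (fun k _ => (hz k).le) (Finset.mem_univ l))) (hη.1 l).le
      _ = _ := by rw [← Finset.sum_mul, hη.2, one_mul]
  have h2 : 0 ≤ ∑ l, η l * ((2 + 3 / π l) * (1 / z l)) := Finset.sum_nonneg fun l _ => by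
    have := hη.1 l
    have := hπ l
    have := hz l
    positivity
  rw [lyap]
  linarith

/-- The total degrees of the types, increased by one. -/
noncomputable def shiftedDeg (G₀ : SimpleGraph (Fin n₀)) (attr₀ : Fin n₀ → Fin K)
    (x : Evolution K n₀) (n : ℕ) (l : Fin K) : ℝ := typeDeg G₀ attr₀ x n l + 1

theorem one_le_shiftedDeg (x : Evolution K n₀) (n : ℕ) (l : Fin K) :
    1 ≤ shiftedDeg G₀ attr₀ x n l := by
  have := typeDeg_nonneg G₀ attr₀ x n l
  rw [shiftedDeg]; linarith

theorem shiftedDeg_pos (x : Evolution K n₀) (n : ℕ) (l : Fin K) :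
    0 < shiftedDeg G₀ attr₀ x n l := one_pos.trans_le (one_le_shiftedDeg x n l)

theorem sum_shiftedDeg (x : Evolution K n₀) (n : ℕ) :
    ∑ l, shiftedDeg G₀ attr₀ x n l = baseDeg G₀ attr₀ x + 2 * n + K := by
  simp [shiftedDeg, Finset.sum_add_distrib, sum_typeDeg]

theorem shiftedDeg_congr {x y : Evolution K n₀} {n : ℕ} (h : ∀ i < n, x i = y i) :
    shiftedDeg G₀ attr₀ x n = shiftedDeg G₀ attr₀ y n :=
  funext fun l => by rw [shiftedDeg, shiftedDeg, typeDeg_congr G₀ attr₀ h]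

theorem shiftedDeg_succ (x : Evolution K n₀) (n : ℕ) : shiftedDeg G₀ attr₀ x (n + 1) =
    fun l => shiftedDeg G₀ attr₀ x n l + typeIncr attr₀ x n (x n) l := by
  funext l
  rw [shiftedDeg, shiftedDeg, typeDeg_succ, typeIncr]
  ring

theorem sum_typeIncr (x : Evolution K n₀) (n : ℕ) (q : Fin K × Fin (n₀ + n)) :
    ∑ l, typeIncr attr₀ x n q l = 2 := by
  simp only [typeIncr, Finset.sum_add_distrib]
  simp
  norm_num

theorem typeIncr_congr {x y : Evolution K n₀} {n : ℕ} (h : ∀ i < n, x i = y i)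
    (q : Fin K × Fin (n₀ + n)) : typeIncr attr₀ x n q = typeIncr attr₀ y n q :=
  funext fun l => by rw [typeIncr, typeIncr, attrOf_congr attr₀ h q.2.isLt]

/-- The average change of the Lyapunov function in a step. -/
theorem lyap_drift [NeZero K] (hπ : ∀ a, 0 < π a) (hπ1 : ∑ a, π a = 1) {k₀ k₁ : ℝ}
    (hk₀ : 0 < k₀) (hk : ∀ a b, k₀ ≤ κ a b) (hk' : ∀ a b, κ a b ≤ k₁)
    (hG₀ : G₀.Connected) (x : Evolution K n₀) (n : ℕ) :
    ∑ q, stepProb π κ G₀ attr₀ x n q * lyap π (minimizer π κ)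
        (fun l => shiftedDeg G₀ attr₀ x n l + typeIncr attr₀ x n q l) ≤
      lyap π (minimizer π κ) (shiftedDeg G₀ attr₀ x n) +
        (k₁ / k₀) ^ 2 / 4 / (∑ l, shiftedDeg G₀ attr₀ x n l) ^ 2 -
        sqDist π (minimizer π κ) (shiftedDeg G₀ attr₀ x n) /
          ∑ l, shiftedDeg G₀ attr₀ x n l := by
  have hκ : ∀ a b, 0 < κ a b := fun a b => hk₀.trans_le (hk a b)
  obtain ⟨hη, -⟩ := minimizer_spec hπ hκ
  have hkey := two_add_le_of_minimizer hπ hπ1 hκ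
    (y := fun l => shiftedDeg G₀ attr₀ x n l / ∑ l, shiftedDeg G₀ attr₀ x n l)
  set η := minimizer π κ
  set y := typeDeg G₀ attr₀ x n with hy
  set z := shiftedDeg G₀ attr₀ x n with hz
  have hy0 : ∀ l, 0 ≤ y l := typeDeg_nonneg G₀ attr₀ x n
  have hz1 : ∀ l, 1 ≤ z l := one_le_shiftedDeg x n
  have hz0 : ∀ l, 0 < z l := shiftedDeg_pos x n
  have hzy : ∀ l, z l = y l + 1 := fun l => rfl
  have hN : 0 < ∑ l, z l := Finset.sum_pos (fun l _ => hz0 l) ⟨0, Finset.mem_univ _⟩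
  set N := ∑ l, z l with hNdef
  -- the gain in a fixed step
  have h1 : ∀ q, -(2 / N) + ∑ l, typeIncr attr₀ x n q l *
      (η l * (1 / z l + 1 / (π l * z l ^ 2))) ≤
      lyap π η z - lyap π η (fun l => z l + typeIncr attr₀ x n q l) := fun q => by
    have hlog : Real.log (∑ l, (z l + typeIncr attr₀ x n q l)) - Real.log N ≤ 2 / N := by
      rw [Finset.sum_add_distrib, sum_typeIncr, ← hNdef, ← Real.log_div (by positivity) hN.ne']
      refine (Real.log_le_sub_one_of_pos (by positivity)).trans (Eq.le ?_)
      field_simp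
      ring
    have hterm : ∀ l, typeIncr attr₀ x n q l * (η l * (1 / z l + 1 / (π l * z l ^ 2))) ≤
        η l * Real.log (z l + typeIncr attr₀ x n q l) - η l * Real.log (z l) +
        (η l * ((2 + 3 / π l) * (1 / z l)) -
          η l * ((2 + 3 / π l) * (1 / (z l + typeIncr attr₀ x n q l)))) := fun l => by
      have := mul_le_mul_of_nonneg_left (log_add_sub_log_ge (hz1 l) 
        (typeIncr_nonneg (attr₀ := attr₀) x n q l) (typeIncr_le_two x n q l) (hπ l)) (hη.1 l).le
      linarith
    have hsum := Finset.sum_le_sum fun l (_ : l ∈ Finset.univ) => hterm l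
    simp only [Finset.sum_add_distrib, Finset.sum_sub_distrib] at hsum hlog
    simp only [lyap, Finset.sum_add_distrib, ← hNdef]
    linarith
  -- the average gain
  have h2 : -(2 / N) + ∑ l, (π l + rate π κ y l * y l) *
      (η l * (1 / z l + 1 / (π l * z l ^ 2))) ≤
      lyap π η z - ∑ q, stepProb π κ G₀ attr₀ x n q *
        lyap π η (fun l => z l + typeIncr attr₀ x n q l) := by
    have hs := add_sum_le_sub_sum (fun q => (stepProb_pos (attr₀ := attr₀) hπ hκ hG₀ x n q).le)
      (sum_stepProb hπ1 hκ hG₀ x n) h1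
    refine le_trans (Eq.le ?_) hs
    congr 1
    simp only [Finset.mul_sum]
    rw [Finset.sum_comm]
    refine Finset.sum_congr rfl fun l _ => ?_
    rw [← sum_stepProb_mul_typeIncr hκ hG₀ x n l, Finset.sum_mul]
    exact Finset.sum_congr rfl fun q _ => by ring
  -- comparison of the average gain with the value at `z`
  have hrz : ∀ l, 0 ≤ rate π κ z l := rate_nonneg hπ hκ fun l => (hz0 l).le
  have hrate : ∀ l, rate π κ z l ≤ rate π κ y l := fun l => by
    refine Finset.sum_le_sum fun b _ => ?_
    refine div_le_div_of_nonneg_left (mul_pos (hπ b) (hκ l b)).le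
      (kernel_sum_typeDeg_pos hκ hG₀ x n b) (Finset.sum_le_sum fun k _ => ?_)
    exact mul_le_mul_of_nonneg_left (by rw [hzy]; linarith) (hκ k b).le
  have h3 : ∀ l, η l * (π l / z l + rate π κ z l) - η l * ((k₁ / k₀) ^ 2 / 4 / N ^ 2) ≤
      (π l + rate π κ y l * y l) * (η l * (1 / z l + 1 / (π l * z l ^ 2))) := fun l => by
    have hr := hrate l
    have hrN : rate π κ z l ≤ k₁ / k₀ / N :=
      rate_le hπ hπ1 hk₀ hk hk' (fun l => (hz0 l).le) hN l
    have hsq : rate π κ z l ^ 2 / 4 ≤ (k₁ / k₀) ^ 2 / 4 / N ^ 2 := by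
      have := pow_le_pow_left₀ (hrz l) hrN 2
      rw [div_pow] at this
      calc rate π κ z l ^ 2 / 4 ≤ (k₁ / k₀) ^ 2 / N ^ 2 / 4 := by linarith
        _ = _ := by ring
    have hm : π l + rate π κ z l * (z l - 1) ≤ π l + rate π κ y l * y l := by
      have := mul_le_mul_of_nonneg_right hr (hy0 l)
      have e : z l - 1 = y l := by rw [hzy]; ring
      rw [e]; linarith
    have hinv : 0 < 1 / z l := one_div_pos.2 (hz0 l)
    have hA : π l / z l + rate π κ z l - rate π κ z l * (1 / z l) ≤
        (π l + rate π κ y l * y l) * (1 / z l) := by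
      refine le_trans (Eq.le ?_) (mul_le_mul_of_nonneg_right hm hinv.le)
      have := (hz0 l).ne'
      field_simp
      ring
    have hB : (1 / z l) ^ 2 ≤ (π l + rate π κ y l * y l) * (1 / (π l * z l ^ 2)) := by
      have h0 : 0 ≤ rate π κ y l * y l := mul_nonneg ((hrz l).trans hr) (hy0 l)
      calc (1 / z l) ^ 2 = π l * (1 / (π l * z l ^ 2)) := by
            have := (hπ l).ne'
            field_simp
        _ ≤ _ := mul_le_mul_of_nonneg_right (by linarith)
            (one_div_nonneg.2 (mul_nonneg (hπ l).le (sq_nonneg _)))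
    have hAB : π l / z l + rate π κ z l - (k₁ / k₀) ^ 2 / 4 / N ^ 2 ≤
        (π l + rate π κ y l * y l) * (1 / z l + 1 / (π l * z l ^ 2)) := by
      -- The shift costs `rate * (1 / z)` and the extra term returns `(1 / z) ^ 2`; completing the
      -- square leaves a loss of at most `rate ^ 2 / 4`, which is of order `1 / N ^ 2`.
      nlinarith [sq_nonneg (rate π κ z l / 2 - 1 / z l)]
    have := mul_le_mul_of_nonneg_left hAB (hη.1 l).le
    linarith
  have h4 := Finset.sum_le_sum fun l (_ : l ∈ Finset.univ) => h3 l
  rw [Finset.sum_sub_distrib, ← Finset.sum_mul, hη.2, one_mul] at h4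
  -- Homogeneity transfers the inequality for `η` from the simplex to `z`. Its `2 / N` cancels the
  -- growth of the logarithm of the total.
  have h5 : (2 + sqDist π η z) / N ≤ ∑ l, η l * (π l / z l + rate π κ z l) := by
    have hmem : (fun l => z l / N) ∈ simplexInterior K :=
      ⟨fun l => div_pos (hz0 l) hN, by rw [← Finset.sum_div, div_self hN.ne']⟩
    rw [div_le_iff₀ hN, Finset.sum_mul]
    refine (hkey hmem).trans (Eq.le ?_)
    refine Finset.sum_congr rfl fun l _ => ?_
    have e : rate π κ z l = rate π κ (fun k => z k / N) l / N := by
      rw [← rate_smul]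
      refine congrArg (fun w => rate π κ w l) (funext fun k => ?_)
      field_simp
    rw [e, rate]
    have := (hz0 l).ne'
    field_simp
  rw [add_div] at h5
  linarith

end Lyapunov

end AttributedPA

namespace AttributedPA

/-! ### Elementary sums and inequalities. -/

section Sums

/-- Comparison with the telescoping terms `1 / ((N - 1) * (N + 1))`, as the denominators advance in
steps of two. -/
theorem sum_inv_sq_le {r : ℝ} (hr : 2 ≤ r) (n : ℕ) :
    ∑ m ∈ Finset.range n, 1 / (r + 2 * m) ^ 2 ≤ 1 / 2 := by
  have key : ∑ m ∈ Finset.range n, 1 / (r + 2 * m) ^ 2 ≤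
      1 / 2 * (1 / (r - 1) - 1 / (r + 2 * n - 1)) := by
    induction n with
    | zero => simp
    | succ n ih =>
      rw [Finset.sum_range_succ]
      have hN : 2 ≤ r + 2 * (n : ℝ) := by
        have : (0 : ℝ) ≤ n := n.cast_nonneg
        linarith
      have : 1 / (r + 2 * (n : ℝ)) ^ 2 ≤
          1 / 2 * (1 / (r + 2 * n - 1) - 1 / (r + 2 * n + 1)) := by
        generalize r + 2 * (n : ℝ) = N at hN
        have e : 1 / 2 * (1 / (N - 1) - 1 / (N + 1)) = 1 / ((N - 1) * (N + 1)) := by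
          have h1 : N - 1 ≠ 0 := by linarith
          have h2 : N + 1 ≠ 0 := by linarith
          field_simp
          ring
        rw [e]
        exact one_div_le_one_div_of_le (mul_pos (by linarith) (by linarith)) (by nlinarith)
      push_cast
      rw [show r + 2 * ((n : ℝ) + 1) - 1 = r + 2 * n + 1 by ring]
      linarith
  have h1 : 1 / (r - 1) ≤ 1 := by
    rw [div_le_one (by linarith)]; linarith
  have h2 : 0 ≤ 1 / (r + 2 * n - 1) := by
    have : (0 : ℝ) ≤ n := n.cast_nonneg
    exact one_div_nonneg.2 (by linarith)
  linarith

/-- The factor `1 / 2`, caused by the step two of the denominators, is the one in the exponent `φ_a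
/ 2`. -/
theorem exists_abs_sum_inv_sub_log_le {r : ℝ} (hr : 2 ≤ r) :
    ∃ b, 0 ≤ b ∧ ∀ n : ℕ, 1 ≤ n →
      |∑ m ∈ Finset.range n, 1 / (r + 2 * m) - 1 / 2 * Real.log n| ≤ b := by
  have hr0 : 0 < r := by linarith
  have hstep : ∀ n : ℕ, 1 / 2 * (Real.log (r + 2 * n) - Real.log r) ≤
      ∑ m ∈ Finset.range n, 1 / (r + 2 * m) ∧ ∑ m ∈ Finset.range n, 1 / (r + 2 * m) ≤
      1 / 2 * (Real.log (r + 2 * n) - Real.log r) + (1 / r - 1 / (r + 2 * n)) := by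
    intro n
    induction n with
    | zero => simp
    | succ n ih =>
      rw [Finset.sum_range_succ]
      push_cast
      rw [show r + 2 * ((n : ℝ) + 1) = r + 2 * n + 2 by ring]
      have hN : 0 < r + 2 * (n : ℝ) := by positivity
      revert ih
      generalize r + 2 * (n : ℝ) = N at hN ⊢
      intro ih
      have h1 := Real.log_le_sub_one_of_pos (show 0 < (N + 2) / N by positivity)
      have h2 := Real.one_sub_inv_le_log_of_pos (show 0 < (N + 2) / N by positivity)
      rw [Real.log_div (by positivity) hN.ne'] at h1 h2
      have e1 : (N + 2) / N - 1 = 2 * (1 / N) := by field_simp; ring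
      have e2 : 1 - ((N + 2) / N)⁻¹ = 2 * (1 / (N + 2)) := by field_simp; ring
      rw [e1] at h1
      rw [e2] at h2
      constructor <;> linarith [ih.1, ih.2]
  refine ⟨1 / 2 * Real.log r + 1 / 2 * Real.log (r + 2) + 1 / r, ?_, fun n hn => ?_⟩
  · have h1 := Real.log_nonneg (show 1 ≤ r by linarith)
    have h2 := Real.log_nonneg (show 1 ≤ r + 2 by linarith)
    positivity
  · have hn1 : (1 : ℝ) ≤ n := by exact_mod_cast hn
    have hn0 : (0 : ℝ) < n := by linarith
    obtain ⟨h1, h2⟩ := hstep n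
    have h3 : Real.log n ≤ Real.log (r + 2 * n) := Real.log_le_log hn0 (by linarith)
    have h4 : Real.log (r + 2 * n) ≤ Real.log (r + 2) + Real.log n := by
      rw [← Real.log_mul (by positivity) hn0.ne']
      exact Real.log_le_log (by positivity) (by nlinarith)
    have h5 : 0 ≤ 1 / (r + 2 * (n : ℝ)) := by positivity
    have h6 : 0 ≤ 1 / r := by positivity
    have h7 := Real.log_nonneg (show 1 ≤ r by linarith)
    have h8 := Real.log_nonneg (show 1 ≤ r + 2 by linarith)
    rw [abs_le]
    constructor <;> linarith

theorem abs_log_one_add_sub_le {t : ℝ} (ht : 0 ≤ t) : |Real.log (1 + t) - t| ≤ t ^ 2 := by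
  have h1 := Real.log_le_sub_one_of_pos (show 0 < 1 + t by linarith)
  have h2 := Real.one_sub_inv_le_log_of_pos (show 0 < 1 + t by linarith)
  have h3 : t - t ^ 2 ≤ 1 - (1 + t)⁻¹ := by
    have : 1 - (1 + t)⁻¹ = t / (1 + t) := by field_simp; ring
    rw [this, le_div_iff₀ (by linarith)]
    nlinarith [pow_nonneg ht 3]
  rw [abs_le]
  constructor <;> nlinarith

/-- Only the squared distance to `η` is controlled when summed against `1 / N`; this trades the
distance itself for that at the price of an arbitrarily small multiple of `log n`. -/
theorem abs_le_add_sq_div {t δ : ℝ} (hδ : 0 < δ) : |t| ≤ δ + t ^ 2 / δ := by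
  rw [← sub_le_iff_le_add', le_div_iff₀ hδ, ← sq_abs]
  nlinarith [sq_nonneg (|t| - δ), abs_nonneg t]

end Sums

/-! ### Pathwise comparison of the logarithm of the normalizer with a harmonic sum. -/

section LogNormalizer

variable {K n₀ : ℕ} {π : Fin K → ℝ} {κ : Fin K → Fin K → ℝ} {G₀ : SimpleGraph (Fin n₀)}
  {attr₀ : Fin n₀ → Fin K}

/-- The normalizing constant of the degrees of the vertices of type `a`. -/
noncomputable def normalizer (π : Fin K → ℝ) (κ : Fin K → Fin K → ℝ) (G₀ : SimpleGraph (Fin n₀))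
    (attr₀ : Fin n₀ → Fin K) (a : Fin K) (x : Evolution K n₀) (n : ℕ) : ℝ :=
  ∏ m ∈ Finset.range n, (1 + rate π κ (typeDeg G₀ attr₀ x m) a)

theorem normalizer_succ (a : Fin K) (x : Evolution K n₀) (n : ℕ) :
    normalizer π κ G₀ attr₀ a x (n + 1) =
      normalizer π κ G₀ attr₀ a x n * (1 + rate π κ (typeDeg G₀ attr₀ x n) a) :=
  Finset.prod_range_succ _ _

theorem typeRate_nonneg (hπ : ∀ a, 0 < π a) (hκ : ∀ a b, 0 < κ a b) (a : Fin K)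
    (x : Evolution K n₀) (n : ℕ) : 0 ≤ rate π κ (typeDeg G₀ attr₀ x n) a :=
  rate_nonneg hπ hκ (typeDeg_nonneg G₀ attr₀ x n) a

theorem typeRate_congr {x y : Evolution K n₀} {n : ℕ} (h : ∀ i < n, x i = y i) :
    rate π κ (typeDeg G₀ attr₀ x n) = rate π κ (typeDeg G₀ attr₀ y n) := by
  rw [show typeDeg G₀ attr₀ x n = typeDeg G₀ attr₀ y n from
    funext fun l => typeDeg_congr G₀ attr₀ h l]

theorem normalizer_pos (hπ : ∀ a, 0 < π a) (hκ : ∀ a b, 0 < κ a b) (a : Fin K)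
    (x : Evolution K n₀) (n : ℕ) : 0 < normalizer π κ G₀ attr₀ a x n :=
  Finset.prod_pos fun m _ => by
    have := typeRate_nonneg (G₀ := G₀) (attr₀ := attr₀) hπ hκ a x m
    linarith

/-- Predictability: the last factor sees the network at time `n - 1` only. For `n = 0` the product
is empty and the truncated subtraction is harmless. -/
theorem normalizer_congr {x y : Evolution K n₀} {n : ℕ} (h : ∀ i < n - 1, x i = y i)
    (a : Fin K) : normalizer π κ G₀ attr₀ a x n = normalizer π κ G₀ attr₀ a y n :=
  Finset.prod_congr rfl fun m hm => by
    rw [typeRate_congr fun i hi => h i (by have := Finset.mem_range.1 hm; omega)]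

/-- With `A` the rate and `N = r + 2 * m`, replacing `log (1 + A)` by `A` costs `O(1 / N ^ 2)`.
Since `φ_a / N` is the rate at `N * η`, the Lipschitz bound reduces the rest to the distance from `N
* η` to the degree vector, which is split by `abs_le_add_sq_div`. -/
theorem abs_log_normalizer_sub_le [NeZero K] (hπ : ∀ a, 0 < π a) (hπ1 : ∑ a, π a = 1)
    (hκ : ∀ a b, 0 < κ a b) (hG₀ : G₀.Connected) (a : Fin K) {r : ℝ}
    (hr : ∀ (x : Evolution K n₀) n, ∑ l, shiftedDeg G₀ attr₀ x n l = r + 2 * n) :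
    ∃ c, 0 ≤ c ∧ ∀ δ, 0 < δ → ∀ (x : Evolution K n₀) (n : ℕ),
      |Real.log (normalizer π κ G₀ attr₀ a x n) -
        phi π κ a * ∑ m ∈ Finset.range n, 1 / (r + 2 * m)| ≤
      ∑ m ∈ Finset.range n, (c * δ * (1 / (r + 2 * m)) +
        c / δ * (sqDist π (minimizer π κ) (shiftedDeg G₀ attr₀ x m) / (r + 2 * m)) +
        c * (1 / (r + 2 * m) ^ 2)) := by
  obtain ⟨k₀, k₁, hk₀, hk₀₁, hk, hk'⟩ := exists_kernel_bounds hκ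
  obtain ⟨hη, -⟩ := minimizer_spec hπ hκ
  set η := minimizer π κ
  obtain ⟨i₀, -, hi₀⟩ := Finset.exists_min_image Finset.univ π ⟨0, Finset.mem_univ _⟩
  have hp₀ : 0 < π i₀ := hπ i₀
  set p₀ := π i₀
  have hk₁ : 0 < k₁ := hk₀.trans_le hk₀₁
  set ρ := k₁ / k₀ with hρ
  have hρ0 : 0 < ρ := div_pos hk₁ hk₀
  set d : ℝ := ρ ^ 2 * (K + 1) with hd
  have hd0 : 0 < d := by positivity
  -- `d * K` covers the `δ` terms of the `K` types and the shift by one, `4 * d / p₀` the passage to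
  -- the weighted `sqDist`, and the last summand bounds the squared rate.
  refine ⟨d * K + 4 * d / p₀ + ρ ^ 2 * (K + 1) ^ 2, by positivity, fun δ hδ x n => ?_⟩
  set c := d * K + 4 * d / p₀ + ρ ^ 2 * (K + 1) ^ 2 with hc
  have hlog : Real.log (normalizer π κ G₀ attr₀ a x n) =
      ∑ m ∈ Finset.range n, Real.log (1 + rate π κ (typeDeg G₀ attr₀ x m) a) :=
    Real.log_prod fun m _ => by
      have := typeRate_nonneg (G₀ := G₀) (attr₀ := attr₀) hπ hκ a x m
      linarith
  rw [hlog, Finset.mul_sum, ← Finset.sum_sub_distrib]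
  refine (Finset.abs_sum_le_sum_abs _ _).trans (Finset.sum_le_sum fun m _ => ?_)
  have hy0 := typeDeg_nonneg G₀ attr₀ x m
  have hs0 := sum_typeDeg_pos (attr₀ := attr₀) hG₀ x m
  have hS1 : 1 ≤ ∑ l, typeDeg G₀ attr₀ x m l := by
    rw [sum_typeDeg]
    have := one_le_baseDeg G₀ attr₀ x hG₀
    have : (0 : ℝ) ≤ m := m.cast_nonneg
    linarith
  have hN := hr x m
  have hNS : r + 2 * (m : ℝ) = ∑ l, typeDeg G₀ attr₀ x m l + K := by
    rw [← hN]; simp [shiftedDeg, Finset.sum_add_distrib]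
  have hN0 : 0 < r + 2 * (m : ℝ) := by rw [hNS]; positivity
  have hNle : r + 2 * (m : ℝ) ≤ (K + 1) * ∑ l, typeDeg G₀ attr₀ x m l := by
    rw [hNS]
    have : (K : ℝ) * 1 ≤ K * ∑ l, typeDeg G₀ attr₀ x m l :=
      mul_le_mul_of_nonneg_left hS1 K.cast_nonneg
    linarith
  have hRN : rate π κ (typeDeg G₀ attr₀ x m) a ≤ ρ / ∑ l, typeDeg G₀ attr₀ x m l :=
    rate_le hπ hπ1 hk₀ hk hk' hy0 hs0 a
  have hLip := abs_rate_sub_rate_le hπ hπ1 hk₀ hk hk' (y := typeDeg G₀ attr₀ x m)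
    (z := fun l => (r + 2 * m) * η l) hy0 (fun l => (mul_pos hN0 (hη.1 l)).le) hs0
    (by rw [← Finset.mul_sum, hη.2, mul_one]; exact hN0) a
  have hφ : rate π κ η a = phi π κ a := (phi_eq_rate a).symm
  rw [rate_smul, hφ, ← Finset.mul_sum, hη.2,
    mul_one] at hLip
  have hdist : ∑ l, |(r + 2 * m) * η l - typeDeg G₀ attr₀ x m l| ≤
      (r + 2 * m) * (K * δ + 4 / (p₀ * δ) * sqDist π η (shiftedDeg G₀ attr₀ x m)) + K := by
    have h1 : ∀ l, |(r + 2 * m) * η l - typeDeg G₀ attr₀ x m l| ≤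
        (r + 2 * m) * (δ + 4 / (p₀ * δ) * (π l *
          ((η l - shiftedDeg G₀ attr₀ x m l / (r + 2 * m)) ^ 2 / 4))) + 1 := fun l => by
      set t := η l - shiftedDeg G₀ attr₀ x m l / (r + 2 * m) with ht
      have e : (r + 2 * m) * η l - typeDeg G₀ attr₀ x m l = (r + 2 * m) * t + 1 := by
        rw [ht, shiftedDeg]; field_simp; ring
      rw [e]
      refine (abs_add_le _ _).trans ?_
      rw [abs_one, abs_mul, abs_of_pos hN0]
      refine add_le_add_left (mul_le_mul_of_nonneg_left ((abs_le_add_sq_div hδ).trans ?_) hN0.le) _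
      have h2 : t ^ 2 / δ * p₀ ≤ t ^ 2 / δ * π l :=
        mul_le_mul_of_nonneg_left (hi₀ l (Finset.mem_univ l)) (by positivity)
      have e2 : 4 / (p₀ * δ) * (π l * (t ^ 2 / 4)) = t ^ 2 / δ * π l / p₀ := by field_simp
      rw [e2]
      have : t ^ 2 / δ ≤ t ^ 2 / δ * π l / p₀ := by rwa [le_div_iff₀ hp₀]
      linarith
    refine (Finset.sum_le_sum fun l _ => h1 l).trans (Eq.le ?_)
    rw [Finset.sum_add_distrib, ← Finset.mul_sum, Finset.sum_add_distrib, ← Finset.mul_sum, sqDist,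
      hN]
    simp
  have hQ : 0 ≤ sqDist π η (shiftedDeg G₀ attr₀ x m) := sqDist_nonneg hπ
  set Q := sqDist π η (shiftedDeg G₀ attr₀ x m)
  set A := rate π κ (typeDeg G₀ attr₀ x m) a
  set S := ∑ l, typeDeg G₀ attr₀ x m l
  set N := r + 2 * (m : ℝ)
  have hSN : 1 / S ≤ (K + 1) / N := by
    rw [div_le_div_iff₀ hs0 hN0]; linarith
  have hA0 : 0 ≤ A := typeRate_nonneg hπ hκ a x m
  have h2 : |A - phi π κ a / N| ≤ d * (K * δ * (1 / N) + 4 / (p₀ * δ) * (Q / N) + K * (1 / N ^ 2)) :=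
    calc |A - phi π κ a / N| ≤ ρ ^ 2 * (N * (K * δ + 4 / (p₀ * δ) * Q) + K) / (S * N) :=
          hLip.trans (by gcongr)
      _ = ρ ^ 2 * (N * (K * δ + 4 / (p₀ * δ) * Q) + K) / N * (1 / S) := by field_simp
      _ ≤ ρ ^ 2 * (N * (K * δ + 4 / (p₀ * δ) * Q) + K) / N * ((K + 1) / N) :=
          mul_le_mul_of_nonneg_left hSN (by positivity)
      _ = _ := by rw [hd]; field_simp
  have h3 : A ^ 2 ≤ ρ ^ 2 * (K + 1) ^ 2 * (1 / N ^ 2) := by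
    have : A ≤ ρ * ((K + 1) / N) :=
      hRN.trans (by rw [div_eq_mul_one_div]; exact mul_le_mul_of_nonneg_left hSN hρ0.le)
    refine (pow_le_pow_left₀ hA0 this 2).trans (Eq.le ?_)
    rw [mul_pow, div_pow]; ring_nf
  have h4 : |Real.log (1 + A) - phi π κ a * (1 / N)| ≤ |Real.log (1 + A) - A| +
      |A - phi π κ a / N| := by
    rw [mul_one_div]; exact abs_sub_le _ _ _
  have h5 := abs_log_one_add_sub_le hA0
  have i1 : 0 ≤ 1 / N := by positivity
  have i2 : 0 ≤ Q / N := by positivity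
  have i3 : 0 ≤ 1 / N ^ 2 := by positivity
  have j1 : d * K * δ * (1 / N) ≤ c * δ * (1 / N) := by
    have : d * K ≤ c := by
      rw [hc]; have : 0 ≤ 4 * d / p₀ + ρ ^ 2 * (K + 1) ^ 2 := by positivity
      linarith
    gcongr
  have j2 : d * (4 / (p₀ * δ)) * (Q / N) ≤ c / δ * (Q / N) := by
    have : 4 * d / p₀ ≤ c := by
      rw [hc]; have : 0 ≤ d * K + ρ ^ 2 * (K + 1) ^ 2 := by positivity
      linarith
    have e : d * (4 / (p₀ * δ)) = 4 * d / p₀ / δ := by field_simp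
    rw [e]
    gcongr
  have j3 : (d * K + ρ ^ 2 * (K + 1) ^ 2) * (1 / N ^ 2) ≤ c * (1 / N ^ 2) := by
    have : d * K + ρ ^ 2 * (K + 1) ^ 2 ≤ c := by
      rw [hc]; have : 0 ≤ 4 * d / p₀ := by positivity
      linarith
    gcongr
  linarith

end LogNormalizer

/-! ### Expected error of the logarithm of the normalizer. -/

section Expectation

variable {K n₀ : ℕ} {π : Fin K → ℝ} {κ : Fin K → Fin K → ℝ} {G₀ : SimpleGraph (Fin n₀)}
  {attr₀ : Fin n₀ → Fin K} {Ω : Type*} [mΩ : MeasurableSpace Ω] {μ : Measure Ω}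
  [IsProbabilityMeasure μ] {X : (n : ℕ) → Ω → Fin K × Fin (n₀ + n)}

/-- The expected drift telescopes; since the Lyapunov function is non-negative and the positive
errors are summable, the total decrease is bounded. -/
theorem IsModelP.sum_integral_sqDist_le [NeZero K] (hX : IsModelP π κ G₀ attr₀ μ X)
    (hπ : ∀ a, 0 < π a) (hπ1 : ∑ a, π a = 1) (hκ : ∀ a b, 0 < κ a b) (hG₀ : G₀.Connected)
    {r : ℝ} (hr2 : 2 ≤ r)
    (hr : ∀ (x : Evolution K n₀) n, ∑ l, shiftedDeg G₀ attr₀ x n l = r + 2 * n) :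
    ∃ B, ∀ n, ∑ m ∈ Finset.range n,
      (∫ ω, sqDist π (minimizer π κ) (shiftedDeg G₀ attr₀ (evo X ω) m) ∂μ) / (r + 2 * m) ≤ B := by
  obtain ⟨k₀, k₁, hk₀, -, hk, hk'⟩ := exists_kernel_bounds hκ
  set η := minimizer π κ
  set ρ := k₁ / k₀
  set u : ℕ → ℝ := fun n => ∫ ω, lyap π η (shiftedDeg G₀ attr₀ (evo X ω) n) ∂μ
  set Q : ℕ → ℝ := fun n => ∫ ω, sqDist π η (shiftedDeg G₀ attr₀ (evo X ω) n) ∂μ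
  have hL : ∀ n, DependsOn (fun x => lyap π η (shiftedDeg G₀ attr₀ x n)) (Set.Iio n) :=
    fun n x y h => by simp only [shiftedDeg_congr h]
  have hQ : ∀ n, DependsOn (fun x => sqDist π η (shiftedDeg G₀ attr₀ x n)) (Set.Iio n) :=
    fun n x y h => by simp only [shiftedDeg_congr h]
  have hstep : ∀ n : ℕ, u (n + 1) ≤ u n + ρ ^ 2 / 4 * (1 / (r + 2 * n) ^ 2) - Q n / (r + 2 * n) := by
    intro n
    have e : u (n + 1) = ∫ ω, ∑ q, stepProb π κ G₀ attr₀ (evo X ω) n q * lyap π η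
        (fun l => shiftedDeg G₀ attr₀ (evo X ω) n l + typeIncr attr₀ (evo X ω) n q l) ∂μ := by
      rw [← hX.integral_step (f := fun x q => lyap π η
        (fun l => shiftedDeg G₀ attr₀ x n l + typeIncr attr₀ x n q l))
        fun q x y h => by simp only [shiftedDeg_congr h, typeIncr_congr h]]
      simp only [u, shiftedDeg_succ]
    have hdep : DependsOn (fun x => ∑ q, stepProb π κ G₀ attr₀ x n q * lyap π η
        (fun l => shiftedDeg G₀ attr₀ x n l + typeIncr attr₀ x n q l)) (Set.Iio n) :=
      fun x y h => by simp only [stepProb_congr h, shiftedDeg_congr h, typeIncr_congr h]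
    have i1 := (hL n).integrable_evo (μ := μ) hX.measurable
    have i2 := (hQ n).integrable_evo (μ := μ) hX.measurable
    rw [e]
    refine (integral_mono (hdep.integrable_evo hX.measurable) ((i1.add (integrable_const
      (ρ ^ 2 / 4 * (1 / (r + 2 * n) ^ 2)))).sub (i2.div_const (r + 2 * n))) fun ω => ?_).trans
      (Eq.le ?_)
    · refine (lyap_drift hπ hπ1 hk₀ hk hk' hG₀ (evo X ω) n).trans (Eq.le ?_)
      simp only [Pi.add_apply, Pi.sub_apply, hr]
      ring
    · have i3 : Integrable (fun ω => lyap π η (shiftedDeg G₀ attr₀ (evo X ω) n) +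
          ρ ^ 2 / 4 * (1 / (r + 2 * n) ^ 2)) μ := i1.add (integrable_const _)
      simp only [Pi.add_apply, Pi.sub_apply]
      rw [integral_sub i3 (i2.div_const _), integral_add i1 (integrable_const _), integral_div]
      simp [u, Q]
  have hu : ∀ n, 0 ≤ u n := fun n => integral_nonneg fun ω =>
    lyap_nonneg hπ (minimizer_spec hπ hκ).1 (shiftedDeg_pos _ n)
  refine ⟨u 0 + ρ ^ 2 / 4 * (1 / 2), fun n => ?_⟩
  have htel : ∑ m ∈ Finset.range n, Q m / (r + 2 * m) ≤
      u 0 - u n + ρ ^ 2 / 4 * ∑ m ∈ Finset.range n, 1 / (r + 2 * m) ^ 2 := by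
    induction n with
    | zero => simp
    | succ n ih =>
      rw [Finset.sum_range_succ, Finset.sum_range_succ, mul_add]
      linarith [hstep n]
  have := mul_le_mul_of_nonneg_left (sum_inv_sq_le hr2 n) (show 0 ≤ ρ ^ 2 / 4 by positivity)
  linarith [hu n]

theorem IsModelP.integral_abs_log_normalizer_le [NeZero K] (hX : IsModelP π κ G₀ attr₀ μ X)
    (hπ : ∀ a, 0 < π a) (hπ1 : ∑ a, π a = 1) (hκ : ∀ a b, 0 < κ a b) (hG₀ : G₀.Connected)
    (a : Fin K) {δ : ℝ} (hδ : 0 < δ) :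
    ∃ B, ∀ n : ℕ, 1 ≤ n → ∫ ω, |Real.log (normalizer π κ G₀ attr₀ a (evo X ω) n) -
      phi π κ a / 2 * Real.log n| ∂μ ≤ δ * Real.log n + B := by
  have hΩ : Nonempty Ω := nonempty_of_isProbabilityMeasure μ
  set r := baseDeg G₀ attr₀ (evo X hΩ.some) + K with hr_def
  have hr2 : 2 ≤ r := by
    have h1 := one_le_baseDeg G₀ attr₀ (evo X hΩ.some) hG₀
    have h2 : (1 : ℝ) ≤ K := by exact_mod_cast NeZero.one_le
    linarith
  have hr : ∀ (x : Evolution K n₀) n, ∑ l, shiftedDeg G₀ attr₀ x n l = r + 2 * n := by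
    intro x n
    rw [sum_shiftedDeg, hr_def, baseDeg_congr G₀ attr₀ x (evo X hΩ.some)]
    ring
  obtain ⟨c, hc, hbound⟩ := abs_log_normalizer_sub_le hπ hπ1 hκ hG₀ a hr
  obtain ⟨B, hB⟩ := hX.sum_integral_sqDist_le hπ hπ1 hκ hG₀ hr2 hr
  obtain ⟨b, hb, hlog⟩ := exists_abs_sum_inv_sub_log_le hr2
  -- The `+ 1` only guards against `c = 0`; what matters is `c * ε ≤ δ`.
  set ε := δ / (c + 1) with hε
  have hε0 : 0 < ε := by positivity
  have hcε : c * ε ≤ δ := by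
    rw [hε, mul_div_assoc', div_le_iff₀ (by positivity)]
    nlinarith
  refine ⟨|phi π κ a| * b + δ * b + c / ε * B + c * (1 / 2), fun n hn => ?_⟩
  have hlog0 : 0 ≤ Real.log n := Real.log_natCast_nonneg n
  set H := ∑ m ∈ Finset.range n, 1 / (r + 2 * (m : ℝ)) with hH
  have hHle : H ≤ 1 / 2 * Real.log n + b := by linarith [(abs_le.1 (hlog n hn)).2]
  have hH0 : 0 ≤ H := Finset.sum_nonneg fun m _ => by positivity
  have hpt : ∀ ω, |Real.log (normalizer π κ G₀ attr₀ a (evo X ω) n) -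
      phi π κ a / 2 * Real.log n| ≤ |phi π κ a| * b + ∑ m ∈ Finset.range n,
        (c * ε * (1 / (r + 2 * m)) +
        c / ε * (sqDist π (minimizer π κ) (shiftedDeg G₀ attr₀ (evo X ω) m) / (r + 2 * m)) +
        c * (1 / (r + 2 * m) ^ 2)) := fun ω => by
    have h1 := hbound ε hε0 (evo X ω) n
    have h2 : |phi π κ a * H - phi π κ a / 2 * Real.log n| ≤ |phi π κ a| * b := by
      rw [show phi π κ a * H - phi π κ a / 2 * Real.log n =
        phi π κ a * (H - 1 / 2 * Real.log n) by ring, abs_mul]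
      exact mul_le_mul_of_nonneg_left (hlog n hn) (abs_nonneg _)
    have h3 := abs_sub_le (Real.log (normalizer π κ G₀ attr₀ a (evo X ω) n))
      (phi π κ a * H) (phi π κ a / 2 * Real.log n)
    linarith
  have hQi : ∀ m, Integrable (fun ω => sqDist π (minimizer π κ)
      (shiftedDeg G₀ attr₀ (evo X ω) m)) μ := fun m =>
    DependsOn.integrable_evo (n := m)
      (f := fun x => sqDist π (minimizer π κ) (shiftedDeg G₀ attr₀ x m)) hX.measurable
      fun x y h => by simp only [shiftedDeg_congr h]
  have hint : ∀ m ∈ Finset.range n, Integrable (fun ω => c * ε * (1 / (r + 2 * (m : ℝ))) +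
      c / ε * (sqDist π (minimizer π κ) (shiftedDeg G₀ attr₀ (evo X ω) m) / (r + 2 * m)) +
        c * (1 / (r + 2 * (m : ℝ)) ^ 2)) μ := fun m _ =>
    (((integrable_const _).add (((hQi m).div_const _).const_mul _)).add (integrable_const _))
  calc _ ≤ ∫ ω, (|phi π κ a| * b + ∑ m ∈ Finset.range n,
        (c * ε * (1 / (r + 2 * m)) +
        c / ε * (sqDist π (minimizer π κ) (shiftedDeg G₀ attr₀ (evo X ω) m) / (r + 2 * m)) +
        c * (1 / (r + 2 * m) ^ 2))) ∂μ :=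
      integral_mono_of_nonneg (ae_of_all _ fun _ => abs_nonneg _)
        ((integrable_const _).add (integrable_finsetSum _ hint)) (ae_of_all _ hpt)
    _ = |phi π κ a| * b + (c * ε * H + c / ε * ∑ m ∈ Finset.range n,
        (∫ ω, sqDist π (minimizer π κ) (shiftedDeg G₀ attr₀ (evo X ω) m) ∂μ) / (r + 2 * m) +
        c * ∑ m ∈ Finset.range n, 1 / (r + 2 * (m : ℝ)) ^ 2) := by
      rw [integral_add (integrable_const _) (integrable_finsetSum _ hint),
        integral_finsetSum _ hint, hH, Finset.mul_sum, Finset.mul_sum, Finset.mul_sum,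
        ← Finset.sum_add_distrib, ← Finset.sum_add_distrib]
      congr 1
      · simp
      · refine Finset.sum_congr rfl fun m _ => ?_
        have i1 : Integrable (fun ω => c * ε * (1 / (r + 2 * (m : ℝ))) + c / ε *
            (sqDist π (minimizer π κ) (shiftedDeg G₀ attr₀ (evo X ω) m) / (r + 2 * m))) μ :=
          (integrable_const _).add (((hQi m).div_const _).const_mul _)
        have e : ∫ ω, c / ε * (sqDist π (minimizer π κ) (shiftedDeg G₀ attr₀ (evo X ω) m) /
            (r + 2 * m)) ∂μ = c / ε * ((∫ ω, sqDist π (minimizer π κ)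
              (shiftedDeg G₀ attr₀ (evo X ω) m) ∂μ) / (r + 2 * m)) := by
          rw [integral_const_mul, integral_div]
        rw [integral_add i1 (integrable_const _), integral_add (integrable_const _)
          (((hQi m).div_const _).const_mul _), e]
        simp
    _ ≤ |phi π κ a| * b + (δ * (1 / 2 * Real.log n + b) + c / ε * B + c * (1 / 2)) := by
      gcongr
      · exact hB n
      · exact sum_inv_sq_le hr2 n
    _ ≤ _ := by nlinarith

end Expectation

end AttributedPA

namespace AttributedPA

/-! ### Rising factorial moments of the degrees of a type. -/

section Moments

/-- Rising factorials are eigenfunctions of `f ↦ d * (f (d + 1) - f d)`, the mean change under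
linear preferential attachment. Hence their mean equations close, which fails for plain powers. -/
theorem mul_ascFactorial_succ_sub (d p : ℕ) :
    (d : ℝ) * (((d + 1).ascFactorial p : ℝ) - d.ascFactorial p) = p * d.ascFactorial p := by
  have := congrArg (Nat.cast (R := ℝ)) (Nat.succ_ascFactorial d p)
  push_cast at this
  rw [mul_sub, this]
  ring

variable {K n₀ : ℕ} {π : Fin K → ℝ} {κ : Fin K → Fin K → ℝ} {G₀ : SimpleGraph (Fin n₀)}
  {attr₀ : Fin n₀ → Fin K}

/-- The sum of the rising factorials of order `p` of the degrees of the vertices of type `a`. -/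
noncomputable def risingSum (G₀ : SimpleGraph (Fin n₀)) (attr₀ : Fin n₀ → Fin K) (a : Fin K)
    (p : ℕ) (x : Evolution K n₀) (n : ℕ) : ℝ :=
  ∑ v : Fin (n₀ + n), if attrOf attr₀ x v = a then ((deg G₀ x v n).ascFactorial p : ℝ) else 0

/-- The increase of `risingSum` in a step. -/
noncomputable def risingIncr (G₀ : SimpleGraph (Fin n₀)) (attr₀ : Fin n₀ → Fin K) (a : Fin K)
    (p : ℕ) (x : Evolution K n₀) (n : ℕ) (q : Fin K × Fin (n₀ + n)) : ℝ :=
  (if attrOf attr₀ x q.2 = a then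
    ((deg G₀ x q.2 n + 1).ascFactorial p : ℝ) - (deg G₀ x q.2 n).ascFactorial p else 0) +
  (if q.1 = a then (p.factorial : ℝ) else 0)

theorem risingSum_nonneg (a : Fin K) (p : ℕ) (x : Evolution K n₀) (n : ℕ) :
    0 ≤ risingSum G₀ attr₀ a p x n :=
  Finset.sum_nonneg fun v _ => by split_ifs <;> positivity

theorem risingSum_congr {x y : Evolution K n₀} {n : ℕ} (h : ∀ i < n, x i = y i) (a : Fin K)
    (p : ℕ) : risingSum G₀ attr₀ a p x n = risingSum G₀ attr₀ a p y n :=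
  Finset.sum_congr rfl fun v _ => by rw [attrOf_congr attr₀ h v.isLt, deg_congr G₀ h]

theorem risingIncr_congr {x y : Evolution K n₀} {n : ℕ} (h : ∀ i < n, x i = y i) (a : Fin K)
    (p : ℕ) (q : Fin K × Fin (n₀ + n)) :
    risingIncr G₀ attr₀ a p x n q = risingIncr G₀ attr₀ a p y n q := by
  rw [risingIncr, risingIncr, attrOf_congr attr₀ h q.2.isLt, deg_congr G₀ h]

theorem risingSum_succ (a : Fin K) (p : ℕ) (x : Evolution K n₀) (n : ℕ) :
    risingSum G₀ attr₀ a p x (n + 1) =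
      risingSum G₀ attr₀ a p x n + risingIncr G₀ attr₀ a p x n (x n) := by
  rw [risingSum, sum_vertices_succ (fun u => if attrOf attr₀ x u = a then
    ((deg G₀ x u (n + 1)).ascFactorial p : ℝ) else 0), risingIncr, ← add_assoc]
  congr 1
  · have : ∀ u : Fin (n₀ + n),
        (if attrOf attr₀ x u = a then ((deg G₀ x u (n + 1)).ascFactorial p : ℝ) else 0) =
        (if attrOf attr₀ x u = a then ((deg G₀ x u n).ascFactorial p : ℝ) else 0) +
          (if u = (x n).2 then (if attrOf attr₀ x (x n).2 = a then
            ((deg G₀ x (x n).2 n + 1).ascFactorial p : ℝ) - (deg G₀ x (x n).2 n).ascFactorial p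
            else 0) else 0) := by
      intro u
      rw [deg_succ, if_neg (show (u : ℕ) ≠ n₀ + n from u.isLt.ne)]
      by_cases hu : u = (x n).2
      · simp only [hu, if_true]
        split_ifs <;> simp
      · have hu' : ((u : ℕ) = ((x n).2 : ℕ)) ↔ False := by
          simpa [Fin.ext_iff] using hu
        simp [hu, hu']
    simp only [this, Finset.sum_add_distrib, risingSum]
    simp
  · rw [attrOf_newVertex, deg_succ, deg_eq_zero G₀ x le_rfl]
    have : n₀ + n ≠ ((x n).2 : ℕ) := (x n).2.isLt.ne'
    simp [this, Nat.one_ascFactorial]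

theorem sum_stepProb_mul_risingIncr (hκ : ∀ a b, 0 < κ a b) (hG₀ : G₀.Connected) (a : Fin K)
    (p : ℕ) (x : Evolution K n₀) (n : ℕ) :
    ∑ q, stepProb π κ G₀ attr₀ x n q * risingIncr G₀ attr₀ a p x n q =
      p * rate π κ (typeDeg G₀ attr₀ x n) a * risingSum G₀ attr₀ a p x n +
        π a * p.factorial := by
  simp only [risingIncr, mul_add, Finset.sum_add_distrib]
  rw [sum_stepProb_mul_fst hκ hG₀ x n fun b => if b = a then (p.factorial : ℝ) else 0,
    sum_stepProb_mul_snd x n fun v => if attrOf attr₀ x v = a then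
      ((deg G₀ x v n + 1).ascFactorial p : ℝ) - (deg G₀ x v n).ascFactorial p else 0]
  congr 1
  · rw [risingSum, Finset.mul_sum]
    refine Finset.sum_congr rfl fun v _ => ?_
    split_ifs with h
    · rw [h, mul_assoc, mul_ascFactorial_succ_sub]; ring
    · ring
  · simp

theorem maxDeg_pow_le_risingSum (a : Fin K) {p : ℕ} (hp : p ≠ 0) (x : Evolution K n₀) (n : ℕ) :
    (maxDeg G₀ attr₀ x a n : ℝ) ^ p ≤ risingSum G₀ attr₀ a p x n := by
  classical
  rw [maxDeg]
  generalize hF : ((Finset.range (n₀ + n)).filter fun v => attrOf attr₀ x v = a) = F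
  have hF' : ∀ v, v ∈ F ↔ v < n₀ + n ∧ attrOf attr₀ x v = a := fun v => by rw [← hF]; simp
  rcases F.eq_empty_or_nonempty with h | h
  · rw [h]; simpa [hp] using risingSum_nonneg a p x n
  · obtain ⟨v, hv, hve⟩ := Finset.exists_mem_eq_sup F h fun v => deg G₀ x v n
    rw [hve]
    obtain ⟨h1, h2⟩ := (hF' v).1 hv
    have h3 : (deg G₀ x v n : ℝ) ^ p ≤ ((deg G₀ x v n).ascFactorial p : ℝ) := by
      exact_mod_cast Nat.pow_succ_le_ascFactorial _ _
    refine h3.trans ?_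
    have h4 := Finset.single_le_sum (f := fun v : Fin (n₀ + n) => if attrOf attr₀ x v = a then
      ((deg G₀ x v n).ascFactorial p : ℝ) else 0) (fun v _ => by split_ifs <;> positivity)
      (Finset.mem_univ (⟨v, h1⟩ : Fin (n₀ + n)))
    simpa [h2, risingSum] using h4

/-- For large `p` the `p`-th power of the normalizing constant grows at least quadratically. -/
theorem exists_le_normalizer_pow [NeZero K] (hπ : ∀ a, 0 < π a) (hπ1 : ∑ a, π a = 1)
    (hκ : ∀ a b, 0 < κ a b) (hG₀ : G₀.Connected) (a : Fin K) (x₀ : Evolution K n₀) :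
    ∃ p : ℕ, 2 ≤ p ∧ ∀ (x : Evolution K n₀) (n : ℕ),
      ((n : ℝ) + 1) * (n + 2) / 2 ≤ normalizer π κ G₀ attr₀ a x n ^ p := by
  obtain ⟨k₀, k₁, hk₀, hk₀₁, hk, hk'⟩ := exists_kernel_bounds hκ
  set s := baseDeg G₀ attr₀ x₀ with hs
  have hs1 : 1 ≤ s := one_le_baseDeg G₀ attr₀ x₀ hG₀
  -- The rate is at least `(k₀ / k₁) / (s + 2 * n)`, so this size of `p` makes `p * rate ≥ 2 / (n +
  -- 1)`. By Bernoulli each new factor is at least `(n + 3) / (n + 1)`, and these multiply to `(n +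
  -- 1) * (n + 2) / 2`. Using `p + 2` secures an order of at least two.
  obtain ⟨p, hp⟩ := exists_nat_ge (2 * (s + 2) / (k₀ / k₁))
  refine ⟨p + 2, by omega, fun x n => ?_⟩
  have hk₁ : 0 < k₁ := hk₀.trans_le hk₀₁
  have hpk : 2 * (s + 2) ≤ ((p + 2 : ℕ) : ℝ) * (k₀ / k₁) := by
    rw [div_le_iff₀ (by positivity)] at hp
    push_cast
    have : 0 < k₀ / k₁ := by positivity
    linarith
  induction n with
  | zero => simp [normalizer]
  | succ n ih =>
    rw [normalizer_succ, mul_pow]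
    have hS : ∑ k, typeDeg G₀ attr₀ x n k = s + 2 * n := by
      rw [sum_typeDeg, hs, baseDeg_congr G₀ attr₀ x x₀]
    have hS0 : 0 < s + 2 * (n : ℝ) := by positivity
    have hrate := le_rate hπ hπ1 hk₀ hk hk' (typeDeg_nonneg G₀ attr₀ x n) (by rw [hS]; exact hS0) a
    rw [hS] at hrate
    have h1 : 2 / ((n : ℝ) + 1) ≤ ((p + 2 : ℕ) : ℝ) * rate π κ (typeDeg G₀ attr₀ x n) a := by
      refine le_trans ?_ (mul_le_mul_of_nonneg_left hrate (Nat.cast_nonneg _))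
      rw [← mul_div_assoc, div_le_div_iff₀ (by positivity) hS0]
      have h2 : 2 * (s + 2 * (n : ℝ)) ≤ 2 * (s + 2) * (n + 1) := by
        have : 0 ≤ s * n := by positivity
        nlinarith
      exact h2.trans (mul_le_mul_of_nonneg_right hpk (by positivity))
    have h2 := one_add_mul_le_pow (a := rate π κ (typeDeg G₀ attr₀ x n) a)
      (by linarith [typeRate_nonneg (G₀ := G₀) (attr₀ := attr₀) hπ hκ a x n]) (p + 2)
    have h3 : 1 + 2 / ((n : ℝ) + 1) ≤ (1 + rate π κ (typeDeg G₀ attr₀ x n) a) ^ (p + 2) := by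
      linarith
    refine le_trans (Eq.le ?_) (mul_le_mul ih h3 (by positivity)
      (pow_nonneg (normalizer_pos hπ hκ a x n).le _))
    push_cast
    field_simp
    ring

variable {Ω : Type*} [mΩ : MeasurableSpace Ω] {μ : Measure Ω}
  [IsProbabilityMeasure μ] {X : (n : ℕ) → Ω → Fin K × Fin (n₀ + n)}

/-- The mean over a step multiplies the sum by `1 + p * rate ≤ (1 + rate) ^ p`, the growth of the
denominator. Only the newcomers add to the quotient, on average at most `p! / C ^ p`, which is
summable for the chosen `p`. -/
theorem IsModelP.exists_integral_risingSum_le [NeZero K] (hX : IsModelP π κ G₀ attr₀ μ X)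
    (hπ : ∀ a, 0 < π a) (hπ1 : ∑ a, π a = 1) (hκ : ∀ a b, 0 < κ a b) (hG₀ : G₀.Connected)
    (a : Fin K) : ∃ p : ℕ, 2 ≤ p ∧ ∃ B, ∀ n, ∫ ω, risingSum G₀ attr₀ a p (evo X ω) n /
      normalizer π κ G₀ attr₀ a (evo X ω) n ^ p ∂μ ≤ B := by
  have hΩ : Nonempty Ω := nonempty_of_isProbabilityMeasure μ
  obtain ⟨p, hp, hC⟩ := exists_le_normalizer_pow (attr₀ := attr₀) hπ hπ1 hκ hG₀ a (evo X hΩ.some)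
  set C := normalizer π κ G₀ attr₀ a
  set R := risingSum G₀ attr₀ a p
  set u : ℕ → ℝ := fun n => ∫ ω, R (evo X ω) n / C (evo X ω) n ^ p ∂μ with hu
  have hC0 : ∀ x n, 0 < C x n := normalizer_pos hπ hκ a
  have hπle : π a ≤ 1 := hπ1 ▸ Finset.single_le_sum (fun b _ => (hπ b).le) (Finset.mem_univ a)
  have hRdep : ∀ n, DependsOn (fun x => R x n / C x n ^ p) (Set.Iio n) := fun n x y h => by
    have h1 : R x n = R y n := risingSum_congr h a p
    have h2 : C x n = C y n := normalizer_congr (fun i hi => h i (show i < n by omega)) a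
    simp only [h1, h2]
  have hstep : ∀ n : ℕ, u (n + 1) ≤ u n + p.factorial * (2 / ((n + 2) * (n + 3))) := by
    intro n
    have hCs : ∀ {x y : Evolution K n₀}, (∀ i < n, x i = y i) → C x (n + 1) = C y (n + 1) :=
      fun h => normalizer_congr h a
    have e : u (n + 1) = ∫ ω, ∑ q, stepProb π κ G₀ attr₀ (evo X ω) n q *
        ((R (evo X ω) n + risingIncr G₀ attr₀ a p (evo X ω) n q) /
          C (evo X ω) (n + 1) ^ p) ∂μ := by
      rw [← hX.integral_step (f := fun x q => (R x n + risingIncr G₀ attr₀ a p x n q) /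
        C x (n + 1) ^ p) fun q x y h => ?_]
      · exact integral_congr_ae (ae_of_all _ fun ω => by simp only [R, risingSum_succ])
      · have h1 : R x n = R y n := risingSum_congr h a p
        simp only [h1, hCs h, risingIncr_congr h]
    have hpt : ∀ x, ∑ q, stepProb π κ G₀ attr₀ x n q *
        ((R x n + risingIncr G₀ attr₀ a p x n q) / C x (n + 1) ^ p) ≤
        R x n / C x n ^ p + p.factorial * (2 / ((n + 2) * (n + 3))) := fun x => by
      have hA := typeRate_nonneg (G₀ := G₀) (attr₀ := attr₀) hπ hκ a x n
      have e1 : ∑ q, stepProb π κ G₀ attr₀ x n q *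
          ((R x n + risingIncr G₀ attr₀ a p x n q) / C x (n + 1) ^ p) =
          R x n * (1 + p * rate π κ (typeDeg G₀ attr₀ x n) a) / C x (n + 1) ^ p +
          π a * p.factorial / C x (n + 1) ^ p := by
        simp only [← mul_div_assoc, mul_add]
        rw [← Finset.sum_div, Finset.sum_add_distrib, ← Finset.sum_mul, sum_stepProb hπ1 hκ hG₀,
          sum_stepProb_mul_risingIncr hκ hG₀]
        ring
      rw [e1]
      refine add_le_add ?_ ?_
      · have h1 := one_add_mul_le_pow (a := rate π κ (typeDeg G₀ attr₀ x n) a) (by linarith) p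
        have h2 : C x (n + 1) = C x n * (1 + rate π κ (typeDeg G₀ attr₀ x n) a) :=
          normalizer_succ a x n
        have h3 : 0 < 1 + rate π κ (typeDeg G₀ attr₀ x n) a := by linarith
        rw [h2, mul_pow, div_le_div_iff₀ (mul_pos (pow_pos (hC0 x n) p) (pow_pos h3 p))
          (pow_pos (hC0 x n) p)]
        have h4 : 0 ≤ R x n * C x n ^ p :=
          mul_nonneg (risingSum_nonneg a p x n) (pow_pos (hC0 x n) p).le
        nlinarith [mul_le_mul_of_nonneg_left h1 h4]
      · have h1 := hC x (n + 1)
        push_cast at h1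
        have h2 : π a * (p.factorial : ℝ) ≤ p.factorial :=
          mul_le_of_le_one_left (Nat.cast_nonneg _) hπle
        calc π a * (p.factorial : ℝ) / C x (n + 1) ^ p ≤
              p.factorial / (((n : ℝ) + 1 + 1) * (n + 1 + 2) / 2) :=
              div_le_div₀ (Nat.cast_nonneg _) h2 (by positivity) h1
          _ = _ := by
            rw [show (n : ℝ) + 1 + 1 = n + 2 by ring, show (n : ℝ) + 1 + 2 = n + 3 by ring]
            field_simp
    have hdep : DependsOn (fun x => ∑ q, stepProb π κ G₀ attr₀ x n q *
        ((R x n + risingIncr G₀ attr₀ a p x n q) / C x (n + 1) ^ p)) (Set.Iio n) :=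
      fun x y h => by
        have h1 : R x n = R y n := risingSum_congr h a p
        simp only [h1, hCs h, risingIncr_congr h, stepProb_congr h]
    have i1 := (hRdep n).integrable_evo (μ := μ) hX.measurable
    rw [e]
    refine (integral_mono (hdep.integrable_evo hX.measurable) (i1.add (integrable_const
      ((p.factorial : ℝ) * (2 / ((n + 2) * (n + 3)))))) fun ω => hpt (evo X ω)).trans (Eq.le ?_)
    simp only [Pi.add_apply]
    rw [integral_add i1 (integrable_const _)]
    simp [hu]
  refine ⟨p, hp, u 0 + p.factorial, fun n => ?_⟩
  have : u n ≤ u 0 + p.factorial * (1 - 2 / ((n : ℝ) + 2)) := by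
    induction n with
    | zero => simp
    | succ n ih =>
      have e : (2 : ℝ) / ((n + 2) * (n + 3)) = 2 / (n + 2) - 2 / (n + 1 + 2) := by
        rw [show (n : ℝ) + 1 + 2 = n + 3 by ring]
        field_simp
        ring
      have := hstep n
      rw [e] at this
      push_cast
      linarith
  have h1 : 0 ≤ (p.factorial : ℝ) * (2 / ((n : ℝ) + 2)) := by positivity
  change u n ≤ _
  linarith

end Moments

end AttributedPA

namespace AttributedPA

/-! ### An `L²` convergence criterion. -/

section LTwo

variable {Ω : Type*} [mΩ : MeasurableSpace Ω] {μ : Measure Ω}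

theorem eLpNorm_two_le_ofReal_sqrt {f : Ω → ℝ} (hf : MemLp f 2 μ) {c : ℝ}
    (h : ∫ ω, f ω ^ 2 ∂μ ≤ c) : eLpNorm f 2 μ ≤ ENNReal.ofReal √c := by
  rw [hf.eLpNorm_eq_integral_rpow_norm two_ne_zero ENNReal.ofNat_ne_top]
  refine ENNReal.ofReal_le_ofReal ?_
  rw [ENNReal.toReal_ofNat, Real.sqrt_eq_rpow, one_div]
  refine Real.rpow_le_rpow (integral_nonneg fun _ => by positivity) (le_trans (Eq.le ?_) h)
    (by norm_num)
  exact integral_congr_ae (ae_of_all _ fun ω => by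
    simp only [Real.norm_eq_abs]
    norm_cast
    exact sq_abs _)

/-- A non-negative process, bounded in `L²`, whose increments after time `n` are non-negatively
correlated with its value at time `n`, converges in `L²` to its almost sure limit. -/
theorem tendsto_eLpNorm_two_of_integral_mul_le [IsFiniteMeasure μ] {f : ℕ → Ω → ℝ} {W : Ω → ℝ}
    (hf : ∀ n, MemLp (f n) 2 μ) {B : ℝ} (hB : ∀ n, ∫ ω, f n ω ^ 2 ∂μ ≤ B)
    (hmono : ∀ n m, n ≤ m → ∫ ω, f n ω * f n ω ∂μ ≤ ∫ ω, f n ω * f m ω ∂μ)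
    (hW : AEStronglyMeasurable W μ)
    (hlim : ∀ᵐ ω ∂μ, Tendsto (fun n => f n ω) atTop (𝓝 (W ω))) :
    MemLp W 2 μ ∧ Tendsto (fun n => eLpNorm (fun ω => f n ω - W ω) 2 μ) atTop (𝓝 0) := by
  set u : ℕ → ℝ := fun n => ∫ ω, f n ω ^ 2 ∂μ with hu
  have hmul : ∀ n m, Integrable (fun ω => f n ω * f m ω) μ := fun n m =>
    (hf n).integrable_mul (hf m)
  -- The correlation hypothesis replaces the orthogonality of martingale increments: after expanding
  -- the square, the mixed term is at least `u n`.
  have hsq : ∀ n m, n ≤ m → ∫ ω, (f n ω - f m ω) ^ 2 ∂μ ≤ u m - u n := fun n m hnm => by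
    have e : ∫ ω, (f n ω - f m ω) ^ 2 ∂μ = u n - 2 * ∫ ω, f n ω * f m ω ∂μ + u m := by
      have i1 : Integrable (fun ω => f n ω ^ 2 - 2 * (f n ω * f m ω)) μ :=
        (hf n).integrable_sq.sub ((hmul n m).const_mul 2)
      rw [← integral_const_mul, hu, ← integral_sub (hf n).integrable_sq ((hmul n m).const_mul 2),
        ← integral_add i1 (hf m).integrable_sq]
      exact integral_congr_ae (ae_of_all _ fun ω => by ring)
    have e2 : u n = ∫ ω, f n ω * f n ω ∂μ :=
      integral_congr_ae (ae_of_all _ fun ω => by ring)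
    have := hmono n m hnm
    rw [e]
    linarith
  have humono : Monotone u := fun n m hnm => by
    have h1 : 0 ≤ ∫ ω, (f n ω - f m ω) ^ 2 ∂μ := integral_nonneg fun _ => sq_nonneg _
    linarith [hsq n m hnm]
  have hbdd : BddAbove (Set.range u) := ⟨B, by rintro _ ⟨n, rfl⟩; exact hB n⟩
  have hulim := tendsto_atTop_ciSup humono hbdd
  -- Fatou's lemma in `m` passes the bound for `f n - f m` to the limit; since `u` increases to its
  -- supremum, this yields both integrability of `W` and convergence.
  have hkey : ∀ n, eLpNorm (fun ω => f n ω - W ω) 2 μ ≤ ENNReal.ofReal √((⨆ i, u i) - u n) := by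
    intro n
    have h1 := Lp.eLpNorm_lim_le_liminf_eLpNorm (p := 2) (μ := μ)
      (f := fun m ω => f n ω - f m ω) (fun m => (hf n).1.sub (hf m).1) (fun ω => f n ω - W ω)
      (hlim.mono fun ω h => tendsto_const_nhds.sub h)
    refine h1.trans (liminf_le_of_frequently_le' (Eventually.frequently ?_))
    filter_upwards [eventually_ge_atTop n] with m hm
    refine eLpNorm_two_le_ofReal_sqrt ((hf n).sub (hf m)) ((hsq n m hm).trans ?_)
    exact sub_le_sub_right (le_ciSup hbdd m) _
  have hmem : ∀ n, MemLp (fun ω => f n ω - W ω) 2 μ := fun n =>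
    ⟨(hf n).1.sub hW, (hkey n).trans_lt ENNReal.ofReal_lt_top⟩
  refine ⟨?_, ?_⟩
  · have := (hf 0).sub (hmem 0)
    refine this.congr_norm hW (ae_of_all _ fun ω => ?_)
    simp
  · refine tendsto_of_tendsto_of_tendsto_of_le_of_le tendsto_const_nhds ?_ (fun _ => zero_le)
      hkey
    have h2 : Tendsto (fun n => √((⨆ i, u i) - u n)) atTop (𝓝 0) := by
      have := (tendsto_const_nhds (x := ⨆ i, u i)).sub hulim
      rw [sub_self] at this
      simpa [Function.comp_def] using (Real.continuous_sqrt.tendsto 0).comp this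
    simpa using ENNReal.tendsto_ofReal h2

end LTwo

/-! ### The normalised degree of the first vertex of a type. -/

section FirstVertex

variable {K n₀ : ℕ} {π : Fin K → ℝ} {κ : Fin K → Fin K → ℝ} {G₀ : SimpleGraph (Fin n₀)}
  {attr₀ : Fin n₀ → Fin K}

/-- The vertices of type `a` at time `n`. -/
def typeSet (attr₀ : Fin n₀ → Fin K) (a : Fin K) (x : Evolution K n₀) (n : ℕ) : Set ℕ :=
  {v | v < n₀ + n ∧ attrOf attr₀ x v = a}

theorem typeSet_congr {x y : Evolution K n₀} {n : ℕ} (h : ∀ i < n, x i = y i) (a : Fin K) :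
    typeSet attr₀ a x n = typeSet attr₀ a y n := by
  ext v
  simp only [typeSet, Set.mem_ofPred_eq]
  exact and_congr_right fun hv => by rw [attrOf_congr attr₀ h hv]

open Classical in
-- Unlike `Nat.find`, `sInf` carries no existence proof, so it can be rewritten along equalities of
-- sets.
theorem firstDeg_eq (a : Fin K) (x : Evolution K n₀) (n : ℕ) :
    firstDeg G₀ attr₀ x a n =
      if (typeSet attr₀ a x n).Nonempty then deg G₀ x (sInf (typeSet attr₀ a x n)) n else 0 := by
  rw [firstDeg]
  by_cases h : ∃ v, v < n₀ + n ∧ attrOf attr₀ x v = a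
  · have h' : (typeSet attr₀ a x n).Nonempty := h
    rw [dif_pos h, if_pos h']
    congr 1
    exact le_antisymm (Nat.find_min' h (Nat.sInf_mem h')) (Nat.sInf_le (Nat.find_spec h))
  · have h' : ¬ (typeSet attr₀ a x n).Nonempty := h
    rw [dif_neg h, if_neg h']

theorem firstDeg_congr {x y : Evolution K n₀} {n : ℕ} (h : ∀ i < n, x i = y i) (a : Fin K) :
    firstDeg G₀ attr₀ x a n = firstDeg G₀ attr₀ y a n := by
  rw [firstDeg_eq, firstDeg_eq, typeSet_congr h, deg_congr G₀ h]

theorem firstDeg_le_maxDeg (a : Fin K) (x : Evolution K n₀) (n : ℕ) :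
    firstDeg G₀ attr₀ x a n ≤ maxDeg G₀ attr₀ x a n := by
  classical
  rw [firstDeg_eq]
  split_ifs with h
  · have h1 := Nat.sInf_mem h
    refine Finset.le_sup (f := fun v => deg G₀ x v n) ?_
    simpa [typeSet] using h1
  · exact Nat.zero_le _

theorem mem_typeSet_succ {a : Fin K} {x : Evolution K n₀} {n v : ℕ} :
    v ∈ typeSet attr₀ a x (n + 1) ↔ v ∈ typeSet attr₀ a x n ∨ (v = n₀ + n ∧ (x n).1 = a) := by
  simp only [typeSet, Set.mem_ofPred_eq]
  constructor
  · rintro ⟨h1, h2⟩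
    rcases Nat.lt_or_ge v (n₀ + n) with h | h
    · exact Or.inl ⟨h, h2⟩
    · obtain rfl : v = n₀ + n := by omega
      exact Or.inr ⟨rfl, by rwa [attrOf_newVertex] at h2⟩
  · rintro (⟨h1, h2⟩ | ⟨rfl, h⟩)
    · exact ⟨by omega, h2⟩
    · exact ⟨by omega, by rwa [attrOf_newVertex]⟩

theorem sInf_typeSet_succ {a : Fin K} {x : Evolution K n₀} {n : ℕ}
    (h : (typeSet attr₀ a x n).Nonempty) :
    sInf (typeSet attr₀ a x (n + 1)) = sInf (typeSet attr₀ a x n) := by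
  have h1 := Nat.sInf_mem h
  refine le_antisymm (Nat.sInf_le (mem_typeSet_succ.2 (Or.inl h1))) ?_
  rcases mem_typeSet_succ.1 (Nat.sInf_mem ⟨_, mem_typeSet_succ.2 (Or.inl h1)⟩) with h2 | h2
  · exact Nat.sInf_le h2
  · rw [h2.1]; exact h1.1.le

open Classical in
/-- The increase of `firstDeg` in a step. -/
noncomputable def firstIncr (attr₀ : Fin n₀ → Fin K) (a : Fin K) (x : Evolution K n₀) (n : ℕ)
    (q : Fin K × Fin (n₀ + n)) : ℝ :=
  if (typeSet attr₀ a x n).Nonempty then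
    (if (q.2 : ℕ) = sInf (typeSet attr₀ a x n) then 1 else 0)
  else (if q.1 = a then 1 else 0)

theorem firstIncr_congr {x y : Evolution K n₀} {n : ℕ} (h : ∀ i < n, x i = y i) (a : Fin K)
    (q : Fin K × Fin (n₀ + n)) : firstIncr attr₀ a x n q = firstIncr attr₀ a y n q := by
  rw [firstIncr, firstIncr, typeSet_congr h]

theorem firstDeg_succ (a : Fin K) (x : Evolution K n₀) (n : ℕ) :
    (firstDeg G₀ attr₀ x a (n + 1) : ℝ) =
      firstDeg G₀ attr₀ x a n + firstIncr attr₀ a x n (x n) := by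
  classical
  rw [firstDeg_eq, firstDeg_eq, firstIncr]
  by_cases h : (typeSet attr₀ a x n).Nonempty
  · have h' : (typeSet attr₀ a x (n + 1)).Nonempty := h.mono fun v hv => mem_typeSet_succ.2 (Or.inl hv)
    have hlt : sInf (typeSet attr₀ a x n) < n₀ + n := (Nat.sInf_mem h).1
    rw [if_pos h, if_pos h', if_pos h, sInf_typeSet_succ h, deg_succ, if_neg hlt.ne]
    simp [eq_comm]
  · rw [if_neg h, if_neg h]
    have hempty : typeSet attr₀ a x n = ∅ := Set.not_nonempty_iff_eq_empty.1 h
    by_cases h1 : (x n).1 = a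
    · have hS : typeSet attr₀ a x (n + 1) = {n₀ + n} := by
        ext v; rw [mem_typeSet_succ, hempty]; simp [h1]
      have : n₀ + n ≠ ((x n).2 : ℕ) := (x n).2.isLt.ne'
      rw [hS, if_pos (Set.singleton_nonempty _), csInf_singleton, deg_succ,
        deg_eq_zero G₀ x le_rfl, if_neg this]
      simp [h1]
    · have hS : typeSet attr₀ a x (n + 1) = ∅ := by
        ext v; rw [mem_typeSet_succ, hempty]; simp [h1]
      rw [hS]
      simp [h1]

theorem sum_stepProb_mul_firstIncr (hκ : ∀ a b, 0 < κ a b) (hG₀ : G₀.Connected) (a : Fin K)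
    (x : Evolution K n₀) (n : ℕ) :
    ((typeSet attr₀ a x n).Nonempty → ∑ q, stepProb π κ G₀ attr₀ x n q * firstIncr attr₀ a x n q =
      rate π κ (typeDeg G₀ attr₀ x n) a * firstDeg G₀ attr₀ x a n) ∧
    (¬ (typeSet attr₀ a x n).Nonempty →
      ∑ q, stepProb π κ G₀ attr₀ x n q * firstIncr attr₀ a x n q = π a) := by
  classical
  constructor
  · intro h
    have h1 := Nat.sInf_mem h
    simp only [firstIncr, if_pos h]
    rw [firstDeg_eq, if_pos h,
      sum_stepProb_mul_snd x n fun v => if (v : ℕ) = sInf (typeSet attr₀ a x n) then 1 else 0,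
      Finset.sum_eq_single (⟨sInf (typeSet attr₀ a x n), h1.1⟩ : Fin (n₀ + n))]
    · simp [h1.2]
    · intro v _ hv
      have : (v : ℕ) ≠ sInf (typeSet attr₀ a x n) := fun e => hv (Fin.ext e)
      simp [this]
    · simp
  · intro h
    simp only [firstIncr, if_neg h]
    rw [sum_stepProb_mul_fst hκ hG₀ x n fun b => if b = a then 1 else 0]
    simp

/-- The normalised degree of the first vertex of type `a`. -/
noncomputable def normalizedDeg (π : Fin K → ℝ) (κ : Fin K → Fin K → ℝ) (G₀ : SimpleGraph (Fin n₀))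
    (attr₀ : Fin n₀ → Fin K) (a : Fin K) (n : ℕ) (x : Evolution K n₀) : ℝ :=
  (firstDeg G₀ attr₀ x a n : ℝ) / normalizer π κ G₀ attr₀ a x n

theorem dependsOn_normalizedDeg (a : Fin K) (n : ℕ) :
    DependsOn (normalizedDeg π κ G₀ attr₀ a n) (Set.Iio n) := fun x y h => by
  rw [normalizedDeg, normalizedDeg, firstDeg_congr h,
    normalizer_congr (fun i hi => h i (show i < n by omega)) a]

theorem normalizedDeg_nonneg (hπ : ∀ a, 0 < π a) (hκ : ∀ a b, 0 < κ a b) (a : Fin K) (n : ℕ)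
    (x : Evolution K n₀) : 0 ≤ normalizedDeg π κ G₀ attr₀ a n x :=
  div_nonneg (Nat.cast_nonneg _) (normalizer_pos hπ hκ a x n).le

variable {Ω : Type*} [mΩ : MeasurableSpace Ω] {μ : Measure Ω}
  [IsProbabilityMeasure μ] {X : (n : ℕ) → Ω → Fin K × Fin (n₀ + n)}

theorem IsModelP.integral_mul_normalizedDeg_succ (hX : IsModelP π κ G₀ attr₀ μ X) (a : Fin K)
    {n : ℕ} {g : Evolution K n₀ → ℝ} (hg : DependsOn g (Set.Iio n)) :
    ∫ ω, g (evo X ω) * normalizedDeg π κ G₀ attr₀ a (n + 1) (evo X ω) ∂μ =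
      ∫ ω, g (evo X ω) * ∑ q, stepProb π κ G₀ attr₀ (evo X ω) n q *
        ((firstDeg G₀ attr₀ (evo X ω) a n + firstIncr attr₀ a (evo X ω) n q) /
          normalizer π κ G₀ attr₀ a (evo X ω) (n + 1)) ∂μ := by
  have := hX.integral_step (n := n) (f := fun x q => g x *
    ((firstDeg G₀ attr₀ x a n + firstIncr attr₀ a x n q) /
      normalizer π κ G₀ attr₀ a x (n + 1))) fun q x y h => by
    have h1 : g x = g y := hg h
    have h2 : normalizer π κ G₀ attr₀ a x (n + 1) = normalizer π κ G₀ attr₀ a y (n + 1) :=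
      normalizer_congr h a
    simp only [h1, h2, firstDeg_congr (G₀ := G₀) (attr₀ := attr₀) h, firstIncr_congr h]
  refine Eq.trans (integral_congr_ae (ae_of_all _ fun ω => ?_)) (this.trans
    (integral_congr_ae (ae_of_all _ fun ω => ?_)))
  · simp only [normalizedDeg, firstDeg_succ]
  · simp only [Finset.mul_sum]
    exact Finset.sum_congr rfl fun q _ => by ring

/-- Once a vertex of type `a` exists, the new factor of the normalizer cancels the mean growth
exactly. Before that the value is `0` and can only rise, so the process is a submartingale and not a
martingale. -/
theorem sum_stepProb_mul_normalizedDeg (hπ : ∀ a, 0 < π a) (hπ1 : ∑ a, π a = 1)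
    (hκ : ∀ a b, 0 < κ a b) (hG₀ : G₀.Connected) (a : Fin K) (x : Evolution K n₀) (n : ℕ) :
    normalizedDeg π κ G₀ attr₀ a n x ≤ ∑ q, stepProb π κ G₀ attr₀ x n q *
        ((firstDeg G₀ attr₀ x a n + firstIncr attr₀ a x n q) /
          normalizer π κ G₀ attr₀ a x (n + 1)) ∧
    ((typeSet attr₀ a x n).Nonempty → ∑ q, stepProb π κ G₀ attr₀ x n q *
        ((firstDeg G₀ attr₀ x a n + firstIncr attr₀ a x n q) /
          normalizer π κ G₀ attr₀ a x (n + 1)) = normalizedDeg π κ G₀ attr₀ a n x) := by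
  classical
  have hA := typeRate_nonneg (G₀ := G₀) (attr₀ := attr₀) hπ hκ a x n
  have hC := normalizer_pos (G₀ := G₀) (attr₀ := attr₀) hπ hκ a x n
  have e : ∑ q, stepProb π κ G₀ attr₀ x n q *
      ((firstDeg G₀ attr₀ x a n + firstIncr attr₀ a x n q) /
        normalizer π κ G₀ attr₀ a x (n + 1)) = (firstDeg G₀ attr₀ x a n +
        ∑ q, stepProb π κ G₀ attr₀ x n q * firstIncr attr₀ a x n q) /
        normalizer π κ G₀ attr₀ a x (n + 1) := by
    simp only [← mul_div_assoc, mul_add]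
    rw [← Finset.sum_div, Finset.sum_add_distrib, ← Finset.sum_mul, sum_stepProb hπ1 hκ hG₀,
      one_mul]
  have hne : (typeSet attr₀ a x n).Nonempty → ∑ q, stepProb π κ G₀ attr₀ x n q *
        ((firstDeg G₀ attr₀ x a n + firstIncr attr₀ a x n q) /
          normalizer π κ G₀ attr₀ a x (n + 1)) = normalizedDeg π κ G₀ attr₀ a n x := fun h => by
    rw [e, (sum_stepProb_mul_firstIncr hκ hG₀ a x n).1 h, normalizer_succ, normalizedDeg]
    have : 1 + rate π κ (typeDeg G₀ attr₀ x n) a ≠ 0 := by linarith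
    field_simp
  refine ⟨?_, hne⟩
  by_cases h : (typeSet attr₀ a x n).Nonempty
  · exact (hne h).ge
  · rw [e, (sum_stepProb_mul_firstIncr hκ hG₀ a x n).2 h, normalizedDeg, firstDeg_eq, if_neg h]
    have := normalizer_pos (G₀ := G₀) (attr₀ := attr₀) hπ hκ a x (n + 1)
    have := hπ a
    simp only [Nat.cast_zero, zero_div, zero_add]
    positivity

theorem dependsOn_stepMean (a : Fin K) (n : ℕ) :
    DependsOn (fun x => ∑ q, stepProb π κ G₀ attr₀ x n q *
      ((firstDeg G₀ attr₀ x a n + firstIncr attr₀ a x n q) /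
        normalizer π κ G₀ attr₀ a x (n + 1))) (Set.Iio n) := fun x y h => by
  have h2 : normalizer π κ G₀ attr₀ a x (n + 1) = normalizer π κ G₀ attr₀ a y (n + 1) :=
    normalizer_congr h a
  simp only [h2, firstDeg_congr (G₀ := G₀) (attr₀ := attr₀) h, firstIncr_congr h,
    stepProb_congr h]

theorem _root_.DependsOn.mul_evo {f g : Evolution K n₀ → ℝ} {s : Set ℕ} (hf : DependsOn f s)
    (hg : DependsOn g s) : DependsOn (fun x => f x * g x) s := fun _ _ h => by
  have h1 := hf h
  have h2 := hg h
  simp only [h1, h2]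

/-- Used with two weights: indicators of past events give the submartingale property, and the
process itself gives the correlation bound for `L²` convergence. -/
theorem IsModelP.integral_mul_normalizedDeg_le (hX : IsModelP π κ G₀ attr₀ μ X)
    (hπ : ∀ a, 0 < π a) (hπ1 : ∑ a, π a = 1) (hκ : ∀ a b, 0 < κ a b) (hG₀ : G₀.Connected)
    (a : Fin K) {n m : ℕ} (hnm : n ≤ m) {g : Evolution K n₀ → ℝ} (hg : DependsOn g (Set.Iio n))
    (hg0 : ∀ x, 0 ≤ g x) :
    ∫ ω, g (evo X ω) * normalizedDeg π κ G₀ attr₀ a n (evo X ω) ∂μ ≤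
      ∫ ω, g (evo X ω) * normalizedDeg π κ G₀ attr₀ a m (evo X ω) ∂μ := by
  induction m, hnm using Nat.le_induction with
  | base => exact le_rfl
  | succ m hm ih =>
    refine ih.trans ?_
    have hg' : DependsOn g (Set.Iio m) := fun x y h => hg fun i hi => h i (lt_of_lt_of_le hi hm)
    rw [hX.integral_mul_normalizedDeg_succ a hg']
    exact integral_mono ((hg'.mul_evo (dependsOn_normalizedDeg a m)).integrable_evo hX.measurable)
      ((hg'.mul_evo (dependsOn_stepMean a m)).integrable_evo hX.measurable) fun ω =>
      mul_le_mul_of_nonneg_left (sum_stepProb_mul_normalizedDeg hπ hπ1 hκ hG₀ a _ m).1 (hg0 _)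

theorem IsModelP.integral_mul_normalizedDeg_eq (hX : IsModelP π κ G₀ attr₀ μ X)
    (hπ : ∀ a, 0 < π a) (hπ1 : ∑ a, π a = 1) (hκ : ∀ a b, 0 < κ a b) (hG₀ : G₀.Connected)
    (a : Fin K) {n m : ℕ} (hnm : n ≤ m) {g : Evolution K n₀ → ℝ} (hg : DependsOn g (Set.Iio n))
    (hg0 : ∀ x, g x ≠ 0 → (typeSet attr₀ a x n).Nonempty) :
    ∫ ω, g (evo X ω) * normalizedDeg π κ G₀ attr₀ a m (evo X ω) ∂μ =
      ∫ ω, g (evo X ω) * normalizedDeg π κ G₀ attr₀ a n (evo X ω) ∂μ := by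
  induction m, hnm using Nat.le_induction with
  | base => rfl
  | succ m hm ih =>
    rw [← ih]
    have hg' : DependsOn g (Set.Iio m) := fun x y h => hg fun i hi => h i (lt_of_lt_of_le hi hm)
    rw [hX.integral_mul_normalizedDeg_succ a hg']
    refine integral_congr_ae (ae_of_all _ fun ω => ?_)
    by_cases h : g (evo X ω) = 0
    · simp only [h, zero_mul]
    · obtain ⟨v, hv1, hv2⟩ := hg0 _ h
      exact congrArg _ ((sum_stepProb_mul_normalizedDeg hπ hπ1 hκ hG₀ a _ m).2
        ⟨v, by omega, hv2⟩)

end FirstVertex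

end AttributedPA

namespace AttributedPA

/-! ### Existence and non-degeneracy of the limit, and the two statements in probability. -/

section Limit

variable {K n₀ : ℕ} {π : Fin K → ℝ} {κ : Fin K → Fin K → ℝ} {G₀ : SimpleGraph (Fin n₀)}
  {attr₀ : Fin n₀ → Fin K} {Ω : Type*} [mΩ : MeasurableSpace Ω] {μ : Measure Ω}
  [IsProbabilityMeasure μ] {X : (n : ℕ) → Ω → Fin K × Fin (n₀ + n)}

/-- Every finite history has positive probability. -/
theorem IsModelP.measureReal_history_pos (hX : IsModelP π κ G₀ attr₀ μ X) (hπ : ∀ a, 0 < π a)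
    (hκ : ∀ a b, 0 < κ a b) (hG₀ : G₀.Connected) (x : Evolution K n₀) (n : ℕ) :
    0 < μ.real {ω | ∀ i < n, X i ω = x i} := by
  induction n with
  | zero => simp
  | succ n ih =>
    have e : {ω | ∀ i < n + 1, X i ω = x i} = {ω | (∀ i < n, X i ω = x i) ∧ X n ω = x n} := by
      ext ω
      simp only [Set.mem_ofPred_eq, Nat.lt_succ_iff_lt_or_eq]
      constructor
      · exact fun h => ⟨fun i hi => h i (Or.inl hi), h n (Or.inr rfl)⟩
      · rintro ⟨h1, h2⟩ i (hi | rfl)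
        · exact h1 i hi
        · exact h2
    rw [e, hX.step_law]
    exact mul_pos (stepProb_pos hπ hκ hG₀ x n (x n)) ih

theorem measurableSet_history (hX : ∀ n, Measurable (X n)) (x : Evolution K n₀) (n : ℕ) :
    MeasurableSet {ω | ∀ i < n, X i ω = x i} := by
  have : {ω | ∀ i < n, X i ω = x i} = ⋂ i, ⋂ (_ : i < n), X i ⁻¹' {x i} := by
    ext ω; simp
  rw [this]
  exact MeasurableSet.iInter fun i => MeasurableSet.iInter fun _ =>
    hX i (measurableSet_singleton _)

theorem IsModelP.submartingale_normalizedDeg (hX : IsModelP π κ G₀ attr₀ μ X)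
    (hπ : ∀ a, 0 < π a) (hπ1 : ∑ a, π a = 1) (hκ : ∀ a b, 0 < κ a b) (hG₀ : G₀.Connected)
    (a : Fin K) :
    Submartingale (fun n ω => normalizedDeg π κ G₀ attr₀ a n (evo X ω))
      ⟨networkSigma X, networkSigma_mono X, networkSigma_le hX.measurable⟩ μ := by
  refine submartingale_of_setIntegral_le_succ (fun n => ?_) (fun n => ?_) fun n s hs => ?_
  · exact (dependsOn_normalizedDeg a n).measurable_evo.stronglyMeasurable
  · exact (dependsOn_normalizedDeg a n).integrable_evo hX.measurable
  · have hs' : MeasurableSet s := networkSigma_le hX.measurable n s hs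
    obtain ⟨S, rfl, hS⟩ := exists_preimage_evo hs
    have e : ∀ f : Evolution K n₀ → ℝ, ∫ ω in {ω | evo X ω ∈ S}, f (evo X ω) ∂μ =
        ∫ ω, S.indicator 1 (evo X ω) * f (evo X ω) ∂μ := fun f => by
      rw [← integral_indicator hs']
      refine integral_congr_ae (ae_of_all _ fun ω => ?_)
      by_cases h : evo X ω ∈ S
      · simp [h, Set.indicator]
      · simp [h, Set.indicator]
    rw [e, e]
    exact hX.integral_mul_normalizedDeg_le hπ hπ1 hκ hG₀ a n.le_succ hS
      fun x => Set.indicator_nonneg (fun _ _ => zero_le_one) x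

theorem normalizedDeg_pow_le (hπ : ∀ a, 0 < π a) (hκ : ∀ a b, 0 < κ a b) (a : Fin K) {p : ℕ}
    (hp : p ≠ 0) (n : ℕ) (x : Evolution K n₀) : normalizedDeg π κ G₀ attr₀ a n x ^ p ≤
      risingSum G₀ attr₀ a p x n / normalizer π κ G₀ attr₀ a x n ^ p := by
  rw [normalizedDeg, div_pow]
  refine div_le_div_of_nonneg_right ?_ (pow_pos (normalizer_pos hπ hκ a x n) p).le
  refine le_trans (pow_le_pow_left₀ (Nat.cast_nonneg _) ?_ p) (maxDeg_pow_le_risingSum a hp x n)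
  exact_mod_cast firstDeg_le_maxDeg a x n

theorem dependsOn_risingSum_div (a : Fin K) (p n : ℕ) : DependsOn (fun x =>
    risingSum G₀ attr₀ a p x n / normalizer π κ G₀ attr₀ a x n ^ p) (Set.Iio n) := fun x y h => by
  have h1 : risingSum G₀ attr₀ a p x n = risingSum G₀ attr₀ a p y n := risingSum_congr h a p
  have h2 : normalizer π κ G₀ attr₀ a x n = normalizer π κ G₀ attr₀ a y n :=
    normalizer_congr (fun i hi => h i (show i < n by omega)) a
  simp only [h1, h2]

theorem IsModelP.exists_integral_sq_le [NeZero K] (hX : IsModelP π κ G₀ attr₀ μ X)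
    (hπ : ∀ a, 0 < π a) (hπ1 : ∑ a, π a = 1) (hκ : ∀ a b, 0 < κ a b) (hG₀ : G₀.Connected)
    (a : Fin K) : ∃ B, ∀ n, ∫ ω, normalizedDeg π κ G₀ attr₀ a n (evo X ω) ^ 2 ∂μ ≤ B := by
  obtain ⟨p, hp, B, hB⟩ := hX.exists_integral_risingSum_le hπ hπ1 hκ hG₀ a
  refine ⟨1 + B, fun n => ?_⟩
  have i1 := (dependsOn_risingSum_div (π := π) (κ := κ) (G₀ := G₀) (attr₀ := attr₀)
    a p n).integrable_evo (μ := μ) hX.measurable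
  calc
    _ ≤ ∫ ω, (1 + risingSum G₀ attr₀ a p (evo X ω) n /
        normalizer π κ G₀ attr₀ a (evo X ω) n ^ p) ∂μ := by
      refine integral_mono
        ((dependsOn_normalizedDeg a n).memLp_evo hX.measurable 2).integrable_sq
        ((integrable_const 1).add i1) fun ω => ?_
      have h0 := normalizedDeg_nonneg (G₀ := G₀) (attr₀ := attr₀) hπ hκ a n (evo X ω)
      refine le_trans ?_ (add_le_add_right (normalizedDeg_pow_le hπ hκ a (by omega) n (evo X ω)) 1)
      rcases le_total (normalizedDeg π κ G₀ attr₀ a n (evo X ω)) 1 with h | h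
      · have h1 := pow_le_one₀ (n := 2) h0 h
        have h2 := pow_nonneg h0 p
        linarith
      · have := pow_le_pow_right₀ h hp
        linarith
    _ ≤ 1 + B := by
      rw [integral_add (integrable_const 1) i1]
      simpa using hB n

/-- The limit of the normalised degrees is not almost surely constant. -/
theorem IsModelP.not_ae_const_of_tendsto (hX : IsModelP π κ G₀ attr₀ μ X)
    (hπ : ∀ a, 0 < π a) (hπ1 : ∑ a, π a = 1) (hκ : ∀ a b, 0 < κ a b) (hG₀ : G₀.Connected)
    (a : Fin K) {W : Ω → ℝ} (hW : MemLp W 2 μ)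
    (hlim : Tendsto (fun n => eLpNorm (fun ω => normalizedDeg π κ G₀ attr₀ a n (evo X ω) - W ω) 2 μ)
      atTop (𝓝 0)) : ¬ ∃ c : ℝ, ∀ᵐ ω ∂μ, W ω = c := by
  rintro ⟨c, hc⟩
  have hn₀ : 0 < n₀ := Fin.pos_iff_nonempty.2 hG₀.nonempty
  have hM : ∀ n, Integrable (fun ω => normalizedDeg π κ G₀ attr₀ a n (evo X ω)) μ := fun n =>
    (dependsOn_normalizedDeg a n).integrable_evo hX.measurable
  have hlim1 : Tendsto (fun n => eLpNorm ((fun ω => normalizedDeg π κ G₀ attr₀ a n (evo X ω)) - W)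
      1 μ) atTop (𝓝 0) :=
    tendsto_of_tendsto_of_tendsto_of_le_of_le tendsto_const_nhds hlim (fun _ => zero_le)
      fun n => eLpNorm_le_eLpNorm_of_exponent_le (by norm_num)
        ((hM n).1.sub hW.1)
  -- On such a history the process is a martingale from time `2` on, so its integral over this event
  -- is preserved in the `L¹` limit; the event has positive probability, which identifies the value
  -- with `c`.
  have key : ∀ x : Evolution K n₀, (x 0).1 = a → normalizedDeg π κ G₀ attr₀ a 2 x = c := by
    intro x hx
    set A := {ω | ∀ i < 2, X i ω = x i} with hA
    have hAm : MeasurableSet A := measurableSet_history hX.measurable x 2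
    have hApos : 0 < μ.real A := hX.measureReal_history_pos hπ hκ hG₀ x 2
    have h1 := tendsto_setIntegral_of_L1' W hW.1 (Eventually.of_forall hM) hlim1 A
    have h2 : ∫ ω in A, W ω ∂μ = c * μ.real A := by
      rw [setIntegral_congr_ae (g := fun _ => c) hAm (hc.mono fun ω h _ => h)]
      simp [mul_comm]
    have h3 : ∀ n, 2 ≤ n → ∫ ω in A, normalizedDeg π κ G₀ attr₀ a n (evo X ω) ∂μ =
        normalizedDeg π κ G₀ attr₀ a 2 x * μ.real A := fun n hn => by
      classical
      set g : Evolution K n₀ → ℝ := fun y => if ∀ i < 2, y i = x i then 1 else 0 with hg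
      have hgdep : DependsOn g (Set.Iio 2) := fun y z h => by
        have hiff : (∀ i < 2, y i = x i) ↔ ∀ i < 2, z i = x i :=
          forall₂_congr fun i hi => by rw [h i hi]
        by_cases hy : ∀ i < 2, y i = x i
        · simp only [hg, if_pos hy, if_pos (hiff.1 hy)]
        · simp only [hg, if_neg hy, if_neg (mt hiff.2 hy)]
      have e : ∀ m, ∫ ω in A, normalizedDeg π κ G₀ attr₀ a m (evo X ω) ∂μ =
          ∫ ω, g (evo X ω) * normalizedDeg π κ G₀ attr₀ a m (evo X ω) ∂μ := fun m => by
        rw [← integral_indicator hAm]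
        refine integral_congr_ae (ae_of_all _ fun ω => ?_)
        simp only [Set.indicator, hg, hA, Set.mem_ofPred_eq]
        split_ifs <;> simp
      rw [e, hX.integral_mul_normalizedDeg_eq hπ hπ1 hκ hG₀ a hn hgdep, ← e]
      · rw [setIntegral_congr_fun (g := fun _ => normalizedDeg π κ G₀ attr₀ a 2 x) hAm
          fun ω hω => dependsOn_normalizedDeg a 2 fun i hi => hω i hi]
        simp [mul_comm]
      · intro y hy
        have hy' : ∀ i < 2, y i = x i := by
          by_contra h
          exact hy (if_neg h)
        refine ⟨n₀, by omega, ?_⟩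
        have := attrOf_newVertex attr₀ y 0
        rw [hy' 0 (by omega), hx] at this
        exact this
    have h4 := tendsto_nhds_unique (h1.congr' ((eventually_ge_atTop 2).mono h3)) tendsto_const_nhds
    rw [h2] at h4
    exact (mul_right_cancel₀ hApos.ne' h4).symm
  have hΩ : Nonempty Ω := nonempty_of_isProbabilityMeasure μ
  -- At time `1` there is a vertex of type `a` and another vertex. The normalizer at time `2` does
  -- not see the second step, so attaching the second newcomer to the first vertex of type `a` or
  -- elsewhere gives two different values.
  let y : Evolution K n₀ := Function.update (evo X hΩ.some) 0 (a, ⟨0, by omega⟩)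
  have hy0 : (y 0).1 = a := by simp [y]
  have hne : (typeSet attr₀ a y 1).Nonempty :=
    ⟨n₀, by omega, (attrOf_newVertex attr₀ y 0).trans hy0⟩
  set w := sInf (typeSet attr₀ a y 1) with hw
  have hwlt : w < n₀ + 1 := (Nat.sInf_mem hne).1
  obtain ⟨u, hult, huw⟩ : ∃ u, u < n₀ + 1 ∧ u ≠ w := by
    rcases eq_or_ne w 0 with h | h
    · exact ⟨1, by omega, by omega⟩
    · exact ⟨0, by omega, h.symm⟩
  have hval : ∀ v (hv : v < n₀ + 1), ((firstDeg G₀ attr₀ y a 1 : ℝ) + if v = w then 1 else 0) /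
      normalizer π κ G₀ attr₀ a y 2 = c := fun v hv => by
    let x : Evolution K n₀ := Function.update y 1 (a, ⟨v, hv⟩)
    have hxy : ∀ i < 1, x i = y i := fun i hi => Function.update_of_ne (by omega) _ _
    have hx1 : x 1 = (a, ⟨v, hv⟩) := Function.update_self _ _ _
    have hx := key x (by rw [hxy 0 one_pos, hy0])
    have h1 : (firstDeg G₀ attr₀ x a 2 : ℝ) =
        firstDeg G₀ attr₀ x a 1 + firstIncr attr₀ a x 1 (x 1) := firstDeg_succ a x 1
    rw [normalizedDeg, h1, firstDeg_congr hxy, firstIncr_congr hxy, firstIncr, if_pos hne, hx1,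
      normalizer_congr (n := 2) hxy] at hx
    exact hx
  have e1 := hval w hwlt
  have e2 := hval u hult
  have hC := normalizer_pos (G₀ := G₀) (attr₀ := attr₀) hπ hκ a y 2
  rw [if_pos rfl, ← e2, if_neg huw, div_left_inj' hC.ne'] at e1
  linarith

theorem IsModelP.exists_limit [NeZero K] (hX : IsModelP π κ G₀ attr₀ μ X)
    (hπ : ∀ a, 0 < π a) (hπ1 : ∑ a, π a = 1) (hκ : ∀ a b, 0 < κ a b) (hG₀ : G₀.Connected)
    (a : Fin K) : ∃ W : Ω → ℝ, Measurable W ∧ (∀ ω, 0 ≤ W ω) ∧ MemLp W 2 μ ∧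
      (∀ᵐ ω ∂μ, Tendsto (fun n => normalizedDeg π κ G₀ attr₀ a n (evo X ω)) atTop (𝓝 (W ω))) ∧
      Tendsto (fun n => eLpNorm
        (fun ω => normalizedDeg π κ G₀ attr₀ a n (evo X ω) - W ω) 2 μ) atTop (𝓝 0) := by
  obtain ⟨B, hB⟩ := hX.exists_integral_sq_le hπ hπ1 hκ hG₀ a
  have hsub := hX.submartingale_normalizedDeg hπ hπ1 hκ hG₀ a
  have h2 : ∀ n, MemLp (fun ω => normalizedDeg π κ G₀ attr₀ a n (evo X ω)) 2 μ := fun n =>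
    (dependsOn_normalizedDeg a n).memLp_evo hX.measurable 2
  have hbdd : ∀ n, eLpNorm (fun ω => normalizedDeg π κ G₀ attr₀ a n (evo X ω)) 1 μ ≤
      (√B).toNNReal := fun n =>
    (eLpNorm_le_eLpNorm_of_exponent_le (by norm_num) (h2 n).1).trans
      (eLpNorm_two_le_ofReal_sqrt (h2 n) (hB n))
  obtain ⟨L, hL, hlim⟩ := measurable_limit_of_tendsto_metrizable_ae
    (fun n => (h2 n).1.aemeasurable) (hsub.exists_ae_tendsto_of_bdd hbdd)
  -- The absolute value makes the limit non-negative at every point and not just almost surely.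
  have hW : Measurable fun ω => |L ω| := hL.abs
  have hlim' : ∀ᵐ ω ∂μ, Tendsto (fun n => normalizedDeg π κ G₀ attr₀ a n (evo X ω)) atTop
      (𝓝 |L ω|) := hlim.mono fun ω h => by
    refine (h.abs).congr fun n => ?_
    exact abs_of_nonneg (normalizedDeg_nonneg hπ hκ a n _)
  obtain ⟨h3, h4⟩ := tendsto_eLpNorm_two_of_integral_mul_le h2 hB
    (fun n m hnm => hX.integral_mul_normalizedDeg_le hπ hπ1 hκ hG₀ a hnm
      (dependsOn_normalizedDeg a n) (normalizedDeg_nonneg hπ hκ a n))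
    hW.aestronglyMeasurable hlim'
  exact ⟨fun ω => |L ω|, hW, fun ω => abs_nonneg _, h3, hlim', h4⟩

theorem IsModelP.tendstoInMeasure_log_normalizer [NeZero K] (hX : IsModelP π κ G₀ attr₀ μ X)
    (hπ : ∀ a, 0 < π a) (hπ1 : ∑ a, π a = 1) (hκ : ∀ a b, 0 < κ a b) (hG₀ : G₀.Connected)
    (a : Fin K) : TendstoInMeasure μ (fun (n : ℕ) ω =>
      (Real.log (normalizer π κ G₀ attr₀ a (evo X ω) n) - phi π κ a / 2 * Real.log n) /
        Real.log n) atTop (fun _ => 0) := by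
  rw [tendstoInMeasure_iff_measureReal_norm]
  intro ε hε
  refine tendsto_order.2 ⟨fun r hr => Eventually.of_forall fun n => hr.trans_le measureReal_nonneg,
    fun r hr => ?_⟩
  -- Markov bounds `ε * log n` times the probability by `ε * r / 2 * log n + B`, which is below `ε *
  -- r * log n` once `log n` exceeds `B / (ε * r / 2)`.
  obtain ⟨B, hB⟩ := hX.integral_abs_log_normalizer_le hπ hπ1 hκ hG₀ a
    (show 0 < ε * r / 2 by positivity)
  have hlog : Tendsto (fun n : ℕ => Real.log n) atTop atTop :=
    Real.tendsto_log_atTop.comp tendsto_natCast_atTop_atTop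
  filter_upwards [eventually_ge_atTop 1, hlog.eventually_gt_atTop 0,
    hlog.eventually_gt_atTop (B / (ε * r / 2))] with n hn hl0 hl
  have hint : Integrable (fun ω => |Real.log (normalizer π κ G₀ attr₀ a (evo X ω) n) -
      phi π κ a / 2 * Real.log n|) μ :=
    DependsOn.integrable_evo (n := n) (f := fun x => |Real.log (normalizer π κ G₀ attr₀ a x n) -
      phi π κ a / 2 * Real.log n|) hX.measurable fun x y h => by
        have h2 : normalizer π κ G₀ attr₀ a x n = normalizer π κ G₀ attr₀ a y n :=
          normalizer_congr (fun i hi => h i (show i < n by omega)) a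
        simp only [h2]
  have hmarkov := mul_meas_ge_le_integral_of_nonneg (ae_of_all μ fun ω => abs_nonneg _) hint
    (ε * Real.log n)
  have hset : {ω | ε ≤ ‖(Real.log (normalizer π κ G₀ attr₀ a (evo X ω) n) -
      phi π κ a / 2 * Real.log n) / Real.log n - 0‖} = {ω | ε * Real.log n ≤
      |Real.log (normalizer π κ G₀ attr₀ a (evo X ω) n) - phi π κ a / 2 * Real.log n|} := by
    ext ω
    simp only [Set.mem_ofPred_eq]
    rw [sub_zero, Real.norm_eq_abs, abs_div, abs_of_pos hl0, le_div_iff₀ hl0]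
  rw [hset]
  have h1 := hmarkov.trans (hB n hn)
  rw [div_lt_iff₀ (by positivity)] at hl
  have h2 : 0 < ε * Real.log n := by positivity
  refine lt_of_mul_lt_mul_left (lt_of_le_of_lt h1 ?_) h2.le
  linarith

/-- The power of `n` splits into `n ^ (ε / 4)` and `n ^ (φ_a / 2 + ε / 4)`. The second factor
exceeds the normalizer with high probability, and the maximal degree over the normalizer reaches `δ
* n ^ (ε / 4)` with vanishing probability by the `p`-th moment bound. -/
theorem IsModelP.tendstoInMeasure_maxDeg [NeZero K] (hX : IsModelP π κ G₀ attr₀ μ X)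
    (hπ : ∀ a, 0 < π a) (hπ1 : ∑ a, π a = 1) (hκ : ∀ a b, 0 < κ a b) (hG₀ : G₀.Connected)
    (a : Fin K) {ε : ℝ} (hε : 0 < ε) : TendstoInMeasure μ (fun (n : ℕ) ω =>
      (maxDeg G₀ attr₀ (evo X ω) a n : ℝ) / (n : ℝ) ^ ((phi π κ a + ε) / 2)) atTop
        (fun _ => 0) := by
  have hC := hX.tendstoInMeasure_log_normalizer hπ hπ1 hκ hG₀ a
  obtain ⟨p, hp, B, hB⟩ := hX.exists_integral_risingSum_le hπ hπ1 hκ hG₀ a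
  rw [tendstoInMeasure_iff_measureReal_norm] at hC ⊢
  intro δ hδ
  have hpow : Tendsto (fun n : ℕ => δ * (n : ℝ) ^ (ε / 4)) atTop atTop :=
    ((tendsto_rpow_atTop (by positivity)).comp tendsto_natCast_atTop_atTop).const_mul_atTop hδ
  have hpow' : Tendsto (fun n : ℕ => B / (δ * (n : ℝ) ^ (ε / 4)) ^ p) atTop (𝓝 0) :=
    tendsto_const_nhds.div_atTop ((tendsto_pow_atTop (by omega)).comp hpow)
  have hsum := (hC (ε / 4) (by positivity)).add hpow'
  rw [add_zero] at hsum
  refine tendsto_of_tendsto_of_tendsto_of_le_of_le' tendsto_const_nhds hsum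
    (Eventually.of_forall fun n => measureReal_nonneg) ?_
  filter_upwards [eventually_ge_atTop 2] with n hn
  have hn1 : (1 : ℝ) < n := by exact_mod_cast hn
  have hn0 : (0 : ℝ) < n := by linarith
  have hl0 : 0 < Real.log n := Real.log_pos hn1
  have hd0 : 0 < δ * (n : ℝ) ^ (ε / 4) := mul_pos hδ (Real.rpow_pos_of_pos hn0 _)
  have hmarkov := mul_meas_ge_le_integral_of_nonneg (μ := μ) (ae_of_all μ fun ω => div_nonneg
    (risingSum_nonneg (G₀ := G₀) (attr₀ := attr₀) a p (evo X ω) n)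
    (pow_pos (normalizer_pos (G₀ := G₀) (attr₀ := attr₀) hπ hκ a (evo X ω) n) p).le)
    ((dependsOn_risingSum_div a p n).integrable_evo hX.measurable) ((δ * (n : ℝ) ^ (ε / 4)) ^ p)
  have hsecond : μ.real {ω | (δ * (n : ℝ) ^ (ε / 4)) ^ p ≤ risingSum G₀ attr₀ a p (evo X ω) n /
      normalizer π κ G₀ attr₀ a (evo X ω) n ^ p} ≤ B / (δ * (n : ℝ) ^ (ε / 4)) ^ p := by
    rw [le_div_iff₀ (by positivity), mul_comm]
    exact hmarkov.trans (hB n)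
  refine le_trans ?_ (add_le_add le_rfl hsecond)
  refine le_trans (measureReal_mono ?_) (measureReal_union_le _ _)
  intro ω hω
  simp only [Set.mem_union, Set.mem_ofPred_eq] at hω ⊢
  by_contra! hcon
  obtain ⟨h1, h2⟩ := hcon
  set C := normalizer π κ G₀ attr₀ a (evo X ω) n
  have hC0 : 0 < C := normalizer_pos hπ hκ a _ n
  set M : ℝ := (maxDeg G₀ attr₀ (evo X ω) a n : ℝ)
  have hM0 : 0 ≤ M := Nat.cast_nonneg _
  have hna : 0 < (n : ℝ) ^ ((phi π κ a + ε) / 2) := Real.rpow_pos_of_pos hn0 _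
  rw [sub_zero, Real.norm_eq_abs, abs_of_nonneg (by positivity), le_div_iff₀ hna] at hω
  rw [sub_zero, Real.norm_eq_abs, abs_div, abs_of_pos hl0, div_lt_iff₀ hl0] at h1
  have hlogC : Real.log C < (phi π κ a / 2 + ε / 4) * Real.log n := by
    linarith [(abs_lt.1 h1).2]
  have hCn : C < (n : ℝ) ^ (phi π κ a / 2 + ε / 4) := by
    rwa [← Real.log_lt_log_iff hC0 (Real.rpow_pos_of_pos hn0 _), Real.log_rpow hn0]
  have h3 : δ * (n : ℝ) ^ (ε / 4) * C ≤ M := by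
    refine le_trans ?_ hω
    have e : (phi π κ a + ε) / 2 = ε / 4 + (phi π κ a / 2 + ε / 4) := by ring
    rw [e, Real.rpow_add hn0, ← mul_assoc]
    exact mul_le_mul_of_nonneg_left hCn.le hd0.le
  have h4 : (δ * (n : ℝ) ^ (ε / 4)) ^ p * C ^ p ≤ risingSum G₀ attr₀ a p (evo X ω) n := by
    rw [← mul_pow]
    exact (pow_le_pow_left₀ (by positivity) h3 p).trans
      (maxDeg_pow_le_risingSum a (by omega) _ n)
  rw [div_lt_iff₀ (by positivity)] at h2
  linarith

end Limit

end AttributedPA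

/-! ### Assembly of the main theorem. -/

theorem theorem3p13 {K : ℕ} (π : Fin K → ℝ) (hπ_pos : ∀ a, 0 < π a) (hπ_sum : ∑ a, π a = 1)
    (κ : Fin K → Fin K → ℝ) (hκ_pos : ∀ a b, 0 < κ a b)
    {n₀ : ℕ} (G₀ : SimpleGraph (Fin n₀)) (hG₀ : G₀.Connected) (attr₀ : Fin n₀ → Fin K)
    {Ω : Type*} [MeasurableSpace Ω] (μ : Measure Ω) [IsProbabilityMeasure μ]
    (X : (n : ℕ) → Ω → Fin K × Fin (n₀ + n))
    (hX : AttributedPA.IsModelP π κ G₀ attr₀ μ X) (a : Fin K) :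
    (∃ (C : ℕ → Ω → ℝ) (W : Ω → ℝ),
      (∀ n ω, 0 < C n ω) ∧
      (∀ n, Measurable[AttributedPA.networkSigma X (n - 1)] (C n)) ∧
      Measurable W ∧ (∀ ω, 0 ≤ W ω) ∧ MemLp W 2 μ ∧
      (¬ ∃ c : ℝ, ∀ᵐ ω ∂μ, W ω = c) ∧
      (∀ᵐ ω ∂μ, Tendsto
        (fun n : ℕ => (AttributedPA.firstDeg G₀ attr₀ (fun i => X i ω) a n : ℝ) / C n ω)
        atTop (𝓝 (W ω))) ∧
      (∀ n, MemLp
        (fun ω => (AttributedPA.firstDeg G₀ attr₀ (fun i => X i ω) a n : ℝ) / C n ω) 2 μ) ∧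
      Tendsto
        (fun n : ℕ => eLpNorm (fun ω =>
          (AttributedPA.firstDeg G₀ attr₀ (fun i => X i ω) a n : ℝ) / C n ω - W ω) 2 μ)
        atTop (𝓝 0) ∧
      TendstoInMeasure μ
        (fun (n : ℕ) ω =>
          (Real.log (C n ω) - AttributedPA.phi π κ a / 2 * Real.log n) / Real.log n)
        atTop (fun _ => 0)) ∧
    (∀ ε : ℝ, 0 < ε →
      TendstoInMeasure μ
        (fun (n : ℕ) ω => (AttributedPA.maxDeg G₀ attr₀ (fun i => X i ω) a n : ℝ) /
          (n : ℝ) ^ ((AttributedPA.phi π κ a + ε) / 2))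
        atTop (fun _ => 0)) := by
  have : NeZero K := ⟨(Fin.pos a).ne'⟩
  obtain ⟨W, hWm, hW0, hW2, hae, hL2⟩ := hX.exists_limit hπ_pos hπ_sum hκ_pos hG₀ a
  refine ⟨⟨fun n ω => AttributedPA.normalizer π κ G₀ attr₀ a (AttributedPA.evo X ω) n, W,
    fun n ω => AttributedPA.normalizer_pos hπ_pos hκ_pos a _ n, fun n => ?_, hWm, hW0, hW2,
    hX.not_ae_const_of_tendsto hπ_pos hπ_sum hκ_pos hG₀ a hW2 hL2, hae,
    fun n => (AttributedPA.dependsOn_normalizedDeg a n).memLp_evo hX.measurable 2, hL2,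
    hX.tendstoInMeasure_log_normalizer hπ_pos hπ_sum hκ_pos hG₀ a⟩,
    fun ε hε => hX.tendstoInMeasure_maxDeg hπ_pos hπ_sum hκ_pos hG₀ a hε⟩
  exact DependsOn.measurable_evo
    (f := fun x => AttributedPA.normalizer π κ G₀ attr₀ a x n) fun x y h =>
      AttributedPA.normalizer_congr h a
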